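/- Let $d\ge 3$, let $e_1,\dots,e_d$ be the canonical basis of $\mathbb{Z}^d$ and $e_{d+i}=-e_i$. Let $E=\{(x,x+e_i): x\in\mathbb{Z}^d,\ 1\le i\le 2d\}$ be the set of directed nearest-neighbour edges of $\mathbb{Z}^d$. Fix $\alpha_1,\dots,\alpha_{2d}>0$ and a $2d\times 2d$ matrix $Z=(Z_{i,j})$ with strictly positive entries. For $u$ in the open simplex $\Delta=\{u\in(0,1]^{2d}:\sum_i u_i=1\}$ put $$\varphi(u)=\prod_{i=1}^{2d}u_i^{\alpha_i-1}\prod_{j=1}^{2d}\Big(\sum_{i=1}^{2d}Z_{j,i}u_i\Big)^{-\alpha_j},\qquad \Phi=\int_\Delta\varphi(u)\,du,$$ where $du=du_1\cdots du_{2d-1}$ is Lebesgue measure on $\Delta$. Let the vectors $(u_{x,x+e_i})_{1\le i\le 2d}$, $x\in\mathbb{Z}^d$, be independent and identically distributed on $\Delta$ with density $\Phi^{-1}\varphi(u)\,du$, and define $$\omega_{(x-e_i,x),(x,x+e_j)}=\frac{Z_{i,j}\,u_{x,x+e_j}}{\sum_{l=1}^{2d}Z_{i,l}\,u_{x,x+e_l}},\qquad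 x\in\mathbb{Z}^d,\ 1\le i,j\le 2d .$$ Write $\mathbb{P}^{(\alpha,Z)}$ for the law of the random environment $\omega$ and $\mathbb{E}^{(\alpha,Z)}$ for its expectation. For a given $\omega$ let $P_{e,\omega}$ be the (quenched) law of the Markov chain $(X_n)_{n\ge0}$ on $E$ started at $e$ with transition probabilities $\omega$, and let $G_\omega(e,e)=\sum_{n\ge0}P_{e,\omega}(X_n=e)\in[1,\infty]$ be its Green function. **Theorem.** Let $\tilde\kappa=\min_{1\le i\le 2d}\alpha_i$ and $e_0\in E$. For every real $s<\tilde\kappa$, $$\mathbb{E}^{(\alpha,Z)}\big[G_\omega(e_0,e_0)^s\big]<\infty .$$ Moreover, for $\mathbb{P}^{(\alpha,Z)}$-almost every $\omega$ the chain $(X_n)$ is transient under $P_{e_0,\omega}$, that is, $P_{e_0,\omega}$-almost surely every edge is visited only finitely often. -/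

import Mathlib

open MeasureTheory ProbabilityTheory
open scoped ENNReal Matrix

namespace HypergeometricRWRE

/-! ### Hypergeometric functions on the simplex -/

section Simplex

variable {ι κ : Type*} [Fintype ι] [Fintype κ]

/-- The open simplex `Δ = {u ∈ (0,1]^ι : ∑ u_i = 1}` (the bound `u_i ≤ 1` is automatic). -/
def openSimplex (ι : Type*) [Fintype ι] : Set (ι → ℝ) :=
  {u | (∀ i, 0 < u i) ∧ ∑ i, u i = 1}

/-- The open simplex as a type. -/
abbrev OpenSimplex (ι : Type*) [Fintype ι] : Type _ := openSimplex ι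

/-- Complete the coordinates `(v_i)_{i ≠ i₀}` by `v_{i₀} = 1 - ∑_{i ≠ i₀} v_i`. -/
noncomputable def completeCoord [DecidableEq ι] (i₀ : ι) (v : {i // i ≠ i₀} → ℝ) : ι → ℝ :=
  fun i => if h : i = i₀ then 1 - ∑ j, v j else v ⟨i, h⟩

/-- The Lebesgue measure `du = ∏_{i ≠ i₀} du_i` on the open simplex, where the coordinate
`u_{i₀} = 1 - ∑_{i ≠ i₀} u_i` is eliminated. It does not depend on the choice of `i₀`. -/
noncomputable def simplexVolume [DecidableEq ι] (i₀ : ι) : Measure (OpenSimplex ι) :=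
  ((volume : Measure ({i // i ≠ i₀} → ℝ)).map (completeCoord i₀)).comap Subtype.val

/-- `φ(α, β; Z; u) = ∏_i u_i^{α_i - 1} ∏_j (Z u)_j^{-β_j}`. -/
noncomputable def phi (α : ι → ℝ) (β : κ → ℝ) (Z : Matrix κ ι ℝ) (u : OpenSimplex ι) : ℝ :=
  (∏ i, u.1 i ^ (α i - 1)) * ∏ j, (Z *ᵥ u.1) j ^ (-β j)

/-- The hypergeometric function `Φ(α, β; Z) = ∫_Δ φ(α, β; Z; u) du`. -/
noncomputable def Phi [DecidableEq ι] (i₀ : ι) (α : ι → ℝ) (β : κ → ℝ) (Z : Matrix κ ι ℝ) : ℝ :=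
  ∫ u, phi α β Z u ∂(simplexVolume i₀)

/-- The law on the simplex with density `Φ(α, α; Z)⁻¹ φ(α, α; Z; u)` with respect to `du`. -/
noncomputable def siteLaw [DecidableEq ι] (i₀ : ι) (α : ι → ℝ) (Z : Matrix ι ι ℝ) :
    Measure (OpenSimplex ι) :=
  (simplexVolume i₀).withDensity
    fun u => ENNReal.ofReal (1 / Phi i₀ α α Z * phi α α Z u)

end Simplex

/-! ### The site law is a probability measure -/

section Normalization

variable {ι κ : Type*} [Fintype ι] [Fintype κ]

lemma measurableSet_simplex :
    MeasurableSet (openSimplex ι) := by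
  have h : openSimplex ι = (⋂ i, {u : ι → ℝ | 0 < u i}) ∩ {u | ∑ i, u i = 1} := by
    ext u; simp [openSimplex]
  rw [h]
  refine MeasurableSet.inter ?_ (measurableSet_eq_fun (by fun_prop) measurable_const)
  exact MeasurableSet.iInter fun i => measurableSet_lt measurable_const (measurable_pi_apply i)

lemma phi_pos {α : ι → ℝ} {β : κ → ℝ} {Z : Matrix κ ι ℝ} (hZ : ∀ j i, 0 < Z j i) [Nonempty ι]
    (u : OpenSimplex ι) : 0 < phi α β Z u := by
  refine mul_pos (Finset.prod_pos fun i _ => Real.rpow_pos_of_pos (u.2.1 i) _)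
    (Finset.prod_pos fun j _ => Real.rpow_pos_of_pos ?_ _)
  simp only [Matrix.mulVec, dotProduct]
  exact Finset.sum_pos (fun i _ => mul_pos (hZ j i) (u.2.1 i)) Finset.univ_nonempty

variable [DecidableEq ι]

lemma completeCoord_self (i₀ : ι) (v : {i // i ≠ i₀} → ℝ) :
    completeCoord i₀ v i₀ = 1 - ∑ j, v j := by simp [completeCoord]

lemma completeCoord_ne (i₀ : ι) (v : {i // i ≠ i₀} → ℝ) (j : {i // i ≠ i₀}) :
    completeCoord i₀ v j = v j := by simp [completeCoord, j.2]

lemma continuous_completeCoord (i₀ : ι) : Continuous (completeCoord i₀) := by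
  refine continuous_pi fun i => ?_
  by_cases h : i = i₀
  · simp only [completeCoord, h, dite_true]; fun_prop
  · simp only [completeCoord, h, dite_false]; fun_prop

lemma measurableEmbedding_completeCoord (i₀ : ι) : MeasurableEmbedding (completeCoord i₀) := by
  refine (continuous_completeCoord i₀).measurableEmbedding fun v w h => ?_
  funext j
  rw [← completeCoord_ne i₀ v j, ← completeCoord_ne i₀ w j, h]

lemma sum_completeCoord (i₀ : ι) (v : {i // i ≠ i₀} → ℝ) : ∑ i, completeCoord i₀ v i = 1 := by
  rw [Fintype.sum_eq_add_sum_subtype_ne _ i₀, completeCoord_self]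
  simp [completeCoord_ne]

/-- Exchange of the roles of the coordinates `k` and `i₀`. -/
noncomputable def swapCoord (i₀ : ι) (k : {i // i ≠ i₀}) (v : {i // i ≠ i₀} → ℝ) :
    {i // i ≠ i₀} → ℝ := Function.update v k (1 - ∑ j, v j)

lemma measurePreserving_swapCoord (i₀ : ι) (k : {i // i ≠ i₀}) :
    MeasurePreserving (swapCoord i₀ k) := by
  let L : ({i // i ≠ i₀} → ℝ) →ₗ[ℝ] ({i // i ≠ i₀} → ℝ) :=
    { toFun := fun v => Function.update v k (-∑ j, v j)
      map_add' := fun v w => by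
        funext j
        by_cases h : j = k
        · subst h; simp [Finset.sum_add_distrib]; ring
        · simp [h]
      map_smul' := fun c v => by
        funext j
        by_cases h : j = k
        · subst h; simp [Finset.mul_sum]
        · simp [h] }
  have hL : ∀ v, L v = Function.update v k (-∑ j, v j) := fun _ => rfl
  have hLL : L ∘ₗ L = LinearMap.id := by
    refine LinearMap.ext fun v => ?_
    simp only [LinearMap.comp_apply, hL, LinearMap.id_apply, Function.update_idem]
    rw [Finset.sum_update_of_mem (Finset.mem_univ k), ← Finset.erase_eq,
      ← Finset.add_sum_erase _ v (Finset.mem_univ k)]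
    simp
  have hdet : LinearMap.det L * LinearMap.det L = 1 := by
    rw [← LinearMap.det_comp, hLL, LinearMap.det_id]
  have habs : |(LinearMap.det L)⁻¹| = 1 := by
    rcases mul_self_eq_one_iff.1 hdet with h | h <;> simp [h]
  have hmap : Measure.map L volume = volume := by
    rw [Real.map_linearMap_volume_pi_eq_smul_volume_pi (left_ne_zero_of_mul_eq_one hdet), habs]
    simp
  have h1 : MeasurePreserving L := ⟨L.continuous_of_finiteDimensional.measurable, hmap⟩
  have h2 := (measurePreserving_add_right (volume : Measure ({i // i ≠ i₀} → ℝ))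
    (Pi.single k 1)).comp h1
  have heq : swapCoord i₀ k = (fun x => x + Pi.single k 1) ∘ L := by
    funext v
    funext j
    by_cases h : j = k
    · subst h; simp [swapCoord, hL]; ring
    · simp [swapCoord, hL, h]
  rw [heq]
  exact h2

lemma measurableEmbedding_swapCoord (i₀ : ι) (k : {i // i ≠ i₀}) :
    MeasurableEmbedding (swapCoord i₀ k) := by
  have hinv : ∀ v, swapCoord i₀ k (swapCoord i₀ k v) = v := by
    intro v
    simp only [swapCoord, Function.update_idem]
    rw [Finset.sum_update_of_mem (Finset.mem_univ k), ← Finset.erase_eq,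
      ← Finset.add_sum_erase _ v (Finset.mem_univ k)]
    simp
  have hc : Measurable (swapCoord i₀ k) := (measurePreserving_swapCoord i₀ k).measurable
  exact (MeasurableEquiv.mk ⟨swapCoord i₀ k, swapCoord i₀ k, hinv, hinv⟩ hc hc).measurableEmbedding

lemma integrable_cutPow {a : ℝ} (ha : 0 < a) :
    Integrable ((Set.Ioc (0 : ℝ) 1).indicator fun t => t ^ (a - 1)) := by
  rw [integrable_indicator_iff measurableSet_Ioc, integrableOn_Ioc_iff_integrableOn_Ioo,
    intervalIntegral.integrableOn_Ioo_rpow_iff one_pos]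
  linarith

lemma integrable_phi (i₀ : ι) {α : ι → ℝ} {β : κ → ℝ} {Z : Matrix κ ι ℝ} (hα : ∀ i, 0 < α i)
    (hβ : ∀ j, 0 < β j) (hZ : ∀ j i, 0 < Z j i) :
    Integrable (phi α β Z) (simplexVolume i₀) := by
  let G : (ι → ℝ) → ℝ := fun u => (∏ i, u i ^ (α i - 1)) * ∏ j, (Z *ᵥ u) j ^ (-β j)
  have hGm : Measurable G := by
    refine Measurable.mul ?_ ?_
    · exact Finset.measurable_prod _ fun i _ => by fun_prop
    · refine Finset.measurable_prod _ fun j _ => ?_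
      have : Measurable fun u : ι → ℝ => (Z *ᵥ u) j := by
        simp only [Matrix.mulVec, dotProduct]; fun_prop
      exact this.pow_const _
  change Integrable (G ∘ Subtype.val) (Measure.comap Subtype.val _)
  rw [← integrableOn_iff_comap_subtypeVal measurableSet_simplex,
    (measurableEmbedding_completeCoord i₀).integrableOn_map_iff]
  have : Nonempty ι := ⟨i₀⟩
  let f : ι → ℝ → ℝ := fun i => (Set.Ioc (0 : ℝ) 1).indicator fun t => t ^ (α i - 1)
  let n : ℝ := Fintype.card ι
  have hn : 1 ≤ n := by
    simp only [n]; exact_mod_cast Fintype.card_pos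
  let P : ({i // i ≠ i₀} → ℝ) → ℝ := fun v => ∏ j : {i // i ≠ i₀}, f j (v j)
  let Q : {i // i ≠ i₀} → ({i // i ≠ i₀} → ℝ) → ℝ := fun k v =>
    ∏ j, f (if j = k then i₀ else j) (swapCoord i₀ k v j)
  have hP : Integrable P :=
    Integrable.fintype_prod (f := fun (j : {i // i ≠ i₀}) => f j) fun j => integrable_cutPow (hα _)
  have hQ : ∀ k, Integrable (Q k) := fun k => by
    have h0 : Integrable fun v : {i // i ≠ i₀} → ℝ => ∏ j, f (if j = k then i₀ else j) (v j) :=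
      Integrable.fintype_prod
        (f := fun (j : {i // i ≠ i₀}) => f (if j = k then i₀ else j))
        fun j => integrable_cutPow (hα _)
    exact ((measurePreserving_swapCoord i₀ k).integrable_comp_emb
      (measurableEmbedding_swapCoord i₀ k)).2 h0
  obtain ⟨z, hz, hzZ⟩ : ∃ z : ℝ, 0 < z ∧ ∀ j i, z ≤ Z j i := by
    rcases isEmpty_or_nonempty κ with h | h
    · exact ⟨1, one_pos, fun j => (h.false j).elim⟩
    · obtain ⟨p, hp⟩ := Finite.exists_min fun p : κ × ι => Z p.1 p.2
      exact ⟨_, hZ p.1 p.2, fun j i => hp (j, i)⟩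
  let M : ℝ := ∑ i, n ^ |α i - 1|
  let B : ℝ := ∏ j, z ^ (-β j)
  have hfnn : ∀ i t, 0 ≤ f i t := fun i t =>
    Set.indicator_nonneg (fun t (ht : t ∈ Set.Ioc (0 : ℝ) 1) => Real.rpow_nonneg ht.1.le _) t
  have hdom : Integrable fun v => (M * B) * (P v + ∑ k, Q k v) :=
    (hP.add (integrable_finsetSum _ fun k _ => hQ k)).const_mul _
  refine Integrable.mono' hdom.integrableOn
    (hGm.comp (continuous_completeCoord i₀).measurable).aestronglyMeasurable ?_
  rw [ae_restrict_iff' ((continuous_completeCoord i₀).measurable measurableSet_simplex)]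
  refine Filter.Eventually.of_forall fun v hv => ?_
  obtain ⟨hpos, hsum⟩ := hv
  set u := completeCoord i₀ v with hu
  have hle : ∀ i, u i ≤ 1 := fun i => by
    rw [← hsum]; exact Finset.single_le_sum (fun j _ => (hpos j).le) (Finset.mem_univ i)
  have hf : ∀ i, f i (u i) = u i ^ (α i - 1) := fun i =>
    Set.indicator_of_mem (show u i ∈ Set.Ioc (0 : ℝ) 1 from ⟨hpos i, hle i⟩) _
  have hM1 : ∀ i, n ^ |α i - 1| ≤ M := fun i =>
    Finset.single_le_sum (f := fun i => n ^ |α i - 1|)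
      (fun j _ => Real.rpow_nonneg (by linarith) _) (Finset.mem_univ i)
  have hM0 : 0 ≤ M := Finset.sum_nonneg fun j _ => Real.rpow_nonneg (by linarith) _
  have hB0 : 0 ≤ B := Finset.prod_nonneg fun j _ => Real.rpow_nonneg hz.le _
  have hZu : ∀ j, z ≤ (Z *ᵥ u) j := fun j => by
    simp only [Matrix.mulVec, dotProduct]
    calc z = ∑ i, z * u i := by rw [← Finset.mul_sum, hsum, mul_one]
      _ ≤ _ := Finset.sum_le_sum fun i _ => mul_le_mul_of_nonneg_right (hzZ j i) (hpos i).le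
  have hBb : ∏ j, (Z *ᵥ u) j ^ (-β j) ≤ B := by
    refine Finset.prod_le_prod (fun j _ => Real.rpow_nonneg (hz.le.trans (hZu j)) _) fun j _ => ?_
    exact Real.rpow_le_rpow_of_nonpos hz (hZu j) (by linarith [hβ j])
  have hPv : P v = ∏ j : {i // i ≠ i₀}, f j (u j) :=
    Finset.prod_congr rfl fun j _ => by rw [hu, completeCoord_ne]
  have hP0 : 0 ≤ P v := Finset.prod_nonneg fun j _ => hfnn _ _
  have hQ0 : ∀ k, 0 ≤ Q k v := fun k => Finset.prod_nonneg fun j _ => hfnn _ _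
  obtain ⟨k, hk⟩ : ∃ k, 1 / n ≤ u k := by
    by_contra! hcon
    have : ∑ i, u i < ∑ _i : ι, 1 / n :=
      Finset.sum_lt_sum_of_nonempty Finset.univ_nonempty fun i _ => hcon i
    rw [hsum, Finset.sum_const, Finset.card_univ, nsmul_eq_mul, mul_one_div_cancel
      (by linarith : n ≠ 0)] at this
    exact lt_irrefl _ this
  have hkb : f k (u k) ≤ M := by
    refine le_trans ?_ (hM1 k)
    rw [hf]
    have hn' : 1 ≤ (u k)⁻¹ := (one_le_inv₀ (hpos k)).2 (hle k)
    have hn'' : (u k)⁻¹ ≤ n := by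
      rw [inv_le_comm₀ (hpos k) (by linarith)]; simpa using hk
    calc u k ^ (α k - 1) = (u k)⁻¹ ^ (-(α k - 1)) := by
          rw [Real.inv_rpow (hpos k).le, Real.rpow_neg (hpos k).le, inv_inv]
      _ ≤ (u k)⁻¹ ^ |α k - 1| := Real.rpow_le_rpow_of_exponent_le hn' (neg_le_abs _)
      _ ≤ n ^ |α k - 1| := Real.rpow_le_rpow (by linarith) hn'' (abs_nonneg _)
  have hmain : ∏ i, f i (u i) ≤ M * (P v + ∑ k, Q k v) := by
    rw [Fintype.prod_eq_mul_prod_subtype_ne _ i₀, ← hPv]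
    by_cases hki : k = i₀
    · subst hki
      have : 0 ≤ ∑ k, Q k v := Finset.sum_nonneg fun k _ => hQ0 k
      exact mul_le_mul hkb (by linarith) hP0 hM0
    · let k' : {i // i ≠ i₀} := ⟨k, hki⟩
      have hQk : f i₀ (u i₀) * P v = f k (u k) * Q k' v := by
        rw [hPv]
        simp only [Q]
        rw [← Finset.mul_prod_erase _ _ (Finset.mem_univ k'),
          ← Finset.mul_prod_erase _ (fun j : {i // i ≠ i₀} =>
            f (if j = k' then i₀ else j) (swapCoord i₀ k' v j)) (Finset.mem_univ k')]
        have hrest : ∀ j ∈ Finset.univ.erase k',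
            f (if j = k' then i₀ else j) (swapCoord i₀ k' v j) = f j (u j) := by
          intro j hj
          have hj' := Finset.ne_of_mem_erase hj
          rw [if_neg hj', hu, completeCoord_ne]
          simp [swapCoord, hj']
        rw [Finset.prod_congr rfl hrest]
        have h1 : swapCoord i₀ k' v k' = u i₀ := by
          rw [hu, completeCoord_self]; simp [swapCoord]
        rw [if_pos rfl, h1]
        simp only [k']
        ring
      rw [hQk]
      have h3 : Q k' v ≤ ∑ k, Q k v :=
        Finset.single_le_sum (f := fun k => Q k v) (fun k _ => hQ0 k) (Finset.mem_univ k')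
      exact mul_le_mul hkb (by linarith) (hQ0 _) hM0
  have hprod : ∏ i, u i ^ (α i - 1) = ∏ i, f i (u i) :=
    Finset.prod_congr rfl fun i _ => (hf i).symm
  have hG : (G ∘ completeCoord i₀) v = (∏ i, f i (u i)) * ∏ j, (Z *ᵥ u) j ^ (-β j) := by
    rw [← hprod]; rfl
  have hp0 : 0 ≤ ∏ i, f i (u i) := Finset.prod_nonneg fun j _ => hfnn _ _
  have hq0 : 0 ≤ ∏ j, (Z *ᵥ u) j ^ (-β j) :=
    Finset.prod_nonneg fun j _ => Real.rpow_nonneg (hz.le.trans (hZu j)) _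
  rw [hG, Real.norm_of_nonneg (mul_nonneg hp0 hq0)]
  calc _ ≤ (M * (P v + ∑ k, Q k v)) * B := mul_le_mul hmain hBb hq0 (hp0.trans hmain)
    _ = _ := by ring

lemma simplexVolume_univ_pos (i₀ : ι) : 0 < simplexVolume i₀ Set.univ := by
  rw [simplexVolume, comap_subtype_coe_apply measurableSet_simplex, Set.image_univ,
    Subtype.range_val, Measure.map_apply (continuous_completeCoord i₀).measurable
      measurableSet_simplex]
  have hset : completeCoord i₀ ⁻¹' openSimplex ι =
      ⋂ i, {v | 0 < completeCoord i₀ v i} := by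
    ext v; simp [openSimplex, sum_completeCoord]
  rw [hset]
  refine (isOpen_iInter_of_finite fun i => isOpen_lt continuous_const
    ((continuous_apply i).comp (continuous_completeCoord i₀))).measure_pos _ ?_
  have hc : (0 : ℝ) < Fintype.card ι := by exact_mod_cast Fintype.card_pos_iff.2 ⟨i₀⟩
  refine ⟨fun _ => 1 / (Fintype.card ι : ℝ), Set.mem_iInter.2 fun i => ?_⟩
  by_cases h : i = i₀
  · subst h
    have h0 : Fintype.card {j // j ≠ i} < Fintype.card ι := Fintype.card_subtype_lt (x := i) (by simp)
    change 0 < completeCoord i _ i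
    rw [completeCoord_self, Finset.sum_const, Finset.card_univ, nsmul_eq_mul, mul_one_div, sub_pos,
      div_lt_one hc]
    exact_mod_cast h0
  · change 0 < completeCoord i₀ _ i
    simp only [completeCoord, h, dite_false]
    positivity

/-- The normalizing constant is finite and positive, so the site law is a probability measure. -/
theorem isProbabilityMeasure_siteLaw (i₀ : ι) {α : ι → ℝ} {Z : Matrix ι ι ℝ}
    (hα : ∀ i, 0 < α i) (hZ : ∀ i j, 0 < Z i j) : IsProbabilityMeasure (siteLaw i₀ α Z) := by
  have : Nonempty ι := ⟨i₀⟩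
  have hint := integrable_phi i₀ hα hα hZ
  have hpos : 0 < Phi i₀ α α Z := by
    refine (integral_pos_iff_support_of_nonneg (fun u => (phi_pos hZ u).le) hint).2 ?_
    have : Function.support (phi α α Z) = Set.univ :=
      Set.eq_univ_of_forall fun u => (phi_pos hZ u).ne'
    rw [this]
    exact simplexVolume_univ_pos i₀
  refine ⟨?_⟩
  rw [siteLaw, withDensity_apply _ MeasurableSet.univ, Measure.restrict_univ,
    ← ofReal_integral_eq_lintegral_ofReal (hint.const_mul _)
      (Filter.Eventually.of_forall fun u => mul_nonneg (by positivity) (phi_pos hZ u).le),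
    integral_const_mul]
  change ENNReal.ofReal (1 / Phi i₀ α α Z * Phi i₀ α α Z) = 1
  rw [one_div_mul_cancel hpos.ne', ENNReal.ofReal_one]

end Normalization

/-! ### The lattice, its arc graph and the environments -/

/-- The `2d` directions: `(i, true)` stands for `e_i` and `(i, false)` for `e_{d+i} = -e_i`. -/
abbrev Dir (d : ℕ) : Type := Fin d × Bool

/-- The unit vector of `ℤ^d` belonging to a direction. -/
def dirVec {d : ℕ} : Dir d → (Fin d → ℤ)
  | (i, true) => Pi.single i 1
  | (i, false) => -Pi.single i 1

/-- The directed edges of `ℤ^d`: the pair `(x, i)` stands for the edge `(x, x + e_i)`. -/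
abbrev Edge (d : ℕ) : Type := (Fin d → ℤ) × Dir d

/-- The head `x + e_i` of the edge `(x, x + e_i)`. -/
def head {d : ℕ} (e : Edge d) : Fin d → ℤ := e.1 + dirVec e.2

/-- The space `Ω_K` of environments on the arc graph. The arcs leaving an edge `e` end in the
edges `(head e, j)`, and `(ω e).1 j` is the transition probability from `e` to `(head e, j)`. -/
abbrev Environment (d : ℕ) : Type := Edge d → OpenSimplex (Dir d)

/-- The law of the independent vectors `(u_{(x, x + e_i)})_i`, `x ∈ ℤ^d`. -/
noncomputable def vertexLaw {d : ℕ} [NeZero d] (α : Dir d → ℝ) (Z : Matrix (Dir d) (Dir d) ℝ) :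
    Measure ((Fin d → ℤ) → OpenSimplex (Dir d)) :=
  Measure.infinitePi fun _ => siteLaw ((0, true)) α Z

lemma sum_pos_of_simplex {d : ℕ} {Z : Matrix (Dir d) (Dir d) ℝ} (hZ : ∀ i j, 0 < Z i j)
    (u : OpenSimplex (Dir d)) (i : Dir d) : 0 < ∑ l, Z i l * u.1 l := by
  have hne : (Finset.univ : Finset (Dir d)).Nonempty := ⟨i, Finset.mem_univ i⟩
  exact Finset.sum_pos (fun l _ => mul_pos (hZ i l) (u.2.1 l)) hne

/-- The environment built from `u`: for `e = (x - e_i, x)`, the transition probability from `e` to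
`(x, x + e_j)` is `Z_{i,j} u_{(x, x + e_j)} / ∑_l Z_{i,l} u_{(x, x + e_l)}`. -/
noncomputable def toEnvironment {d : ℕ} (Z : Matrix (Dir d) (Dir d) ℝ) (hZ : ∀ i j, 0 < Z i j)
    (u : (Fin d → ℤ) → OpenSimplex (Dir d)) : Environment d :=
  fun e => ⟨fun j => Z e.2 j * (u (head e)).1 j / ∑ l, Z e.2 l * (u (head e)).1 l,
    fun j => div_pos (mul_pos (hZ e.2 j) ((u (head e)).2.1 j)) (sum_pos_of_simplex hZ _ _),
    by rw [← Finset.sum_div, div_self (sum_pos_of_simplex hZ _ _).ne']⟩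

/-- The law `ℙ^{(α,Z)}` of the random environment on `Ω_K`. -/
noncomputable def envLaw {d : ℕ} [NeZero d] (α : Dir d → ℝ) (Z : Matrix (Dir d) (Dir d) ℝ)
    (hZ : ∀ i j, 0 < Z i j) : Measure (Environment d) :=
  (vertexLaw α Z).map (toEnvironment Z hZ)

lemma measurable_toEnvironment {d : ℕ} (Z : Matrix (Dir d) (Dir d) ℝ) (hZ : ∀ i j, 0 < Z i j) :
    Measurable (toEnvironment Z hZ) := by
  have h : ∀ (x : Fin d → ℤ) (j : Dir d),
      Measurable fun u : (Fin d → ℤ) → OpenSimplex (Dir d) => (u x).1 j := fun x j =>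
    (measurable_pi_apply j).comp (measurable_subtype_coe.comp (measurable_pi_apply x))
  refine measurable_pi_lambda _ fun e => Measurable.subtype_mk ?_
  refine measurable_pi_lambda _ fun j => ?_
  exact ((h _ j).const_mul _).div
    (Finset.measurable_sum _ fun l _ => (h _ l).const_mul _)

theorem isProbabilityMeasure_envLaw {d : ℕ} [NeZero d] {α : Dir d → ℝ}
    {Z : Matrix (Dir d) (Dir d) ℝ} (hα : ∀ i, 0 < α i) (hZ : ∀ i j, 0 < Z i j) :
    IsProbabilityMeasure (envLaw α Z hZ) := by
  have := isProbabilityMeasure_siteLaw ((0, true) : Dir d) hα hZ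
  have : IsProbabilityMeasure (vertexLaw α Z) := by
    rw [vertexLaw]; infer_instance
  exact Measure.isProbabilityMeasure_map (measurable_toEnvironment Z hZ).aemeasurable

/-! ### The quenched walk -/

/-- The transition kernel on the edges given by an environment. -/
noncomputable def stepKernel {d : ℕ} (ω : Environment d) : Kernel (Edge d) (Edge d) where
  toFun e := ∑ j, ENNReal.ofReal ((ω e).1 j) • Measure.dirac (head e, j)
  measurable' := measurable_of_countable _

instance {d : ℕ} (ω : Environment d) : IsMarkovKernel (stepKernel ω) where
  isProbabilityMeasure e := ⟨by
    have h : (stepKernel ω) e = ∑ j, ENNReal.ofReal ((ω e).1 j) • Measure.dirac (head e, j) := rfl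
    rw [h, Measure.finsetSum_apply]
    simp only [Measure.smul_apply, measure_univ, smul_eq_mul, mul_one]
    rw [← ENNReal.ofReal_sum_of_nonneg fun j _ => ((ω e).2.1 j).le, (ω e).2.2,
      ENNReal.ofReal_one]⟩

/-- The quenched law `P_{e,ω}` on trajectories `(X_n)_{n ≥ 0}`: the Markov chain on the edges
with transition kernel `stepKernel ω` started at `e`. -/
noncomputable def quenchedLaw {d : ℕ} (ω : Environment d) (e : Edge d) : Measure (ℕ → Edge d) :=
  Kernel.traj (X := fun _ => Edge d)
    (fun n => (stepKernel ω).comap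
      (fun h : (Finset.Iic n → Edge d) => h ⟨n, Finset.mem_Iic.2 le_rfl⟩) (measurable_pi_apply _))
    0 (fun _ => e)

/-- The Green function `G_ω(e, e')`: the `P_{e,ω}`-expected number of times `n ≥ 0` with
`X_n = e'`. -/
noncomputable def green {d : ℕ} (ω : Environment d) (e e' : Edge d) : ℝ≥0∞ :=
  ∫⁻ X, (∑' n : ℕ, if X n = e' then 1 else 0) ∂(quenchedLaw ω e)

/-- The walk is transient under `P_{e,ω}`: almost surely it visits every edge only finitely
often. -/
def IsTransient {d : ℕ} (ω : Environment d) (e : Edge d) : Prop :=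
  ∀ᵐ X ∂(quenchedLaw ω e), ∀ e' : Edge d, {n : ℕ | X n = e'}.Finite

end HypergeometricRWRE

/-!
The Green function of the walk is a sum over paths, so an integer power of it, for the walk killed
outside a finite set `B` of vertices, is a sum over tuples of loops at `e₀`. The weight of such a
tuple is a constant times a product over the vertices of monomials in the coordinates of `u_x` and
`Z u_x`, whose exponents count the passages through the edges leaving and entering `x`. Its
expectation is a product of quotients of hypergeometric integrals `Φ(a, b; Z)`, where `a` belongs to
the edges leaving `x` and `b` to the edges entering `x`.

When `∑ a = ∑ b` these integrals satisfy the duality `Φ(a, b; Z) / ∏ Γ(a) = Φ(b, a; Zᵀ) / ∏ Γ(b)`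
(`hyperInt_duality`), which says that the time reversed walk is of the same kind. The Gamma factors
at the two ends of each edge cancel if the edge has the same parameter in both. Let the parameters
instead be balanced at every vertex and agree at both ends of every edge except `e₀`, where they are
`a` and `a + h`. Then the factors of `e₀` are the moments of a beta variable with parameters `a`,
`h`, and the reversed walk is one that survives each departure from `e₀` with this beta distributed
probability `y`. Its Green function at `e₀` is at most `(1 - y)⁻¹`, so that the `q`-th moment is
finite for `q < h`; apart from the normalizations of the tilted laws at the vertices, the bound does
not depend on `B` (`lintegral_tilt_mul_greenSum_pow_le`).

Such parameters are `α + h θ` for a unit flow `θ` from the head of `e₀` to infinity. The flow of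
Pólya's urn on the orthant is explicit (`urnFlow`), and it has finite energy when `d ≥ 3`
(`summable_coneMass_sq`). The law with parameters `α` and the tilted law are compared by Hölder's
inequality, with the exponents `h = t P` for the Green function and `-t Q` for the density of the
tilt, where `s < t`, `P = q / s` and `t Q < min α`. At each vertex the two normalizations have
opposite first order terms, hence their product is at most `exp (C θ_x²)`, where `θ_x` is the flow
through `x`, for all but finitely many `x`; so the product over all vertices is bounded by the
finite energy (`exists_prod_tiltMass_le`). Letting `B` increase to `ℤ^d` gives the moments of the
Green function. Applied to all edges, they give almost sure finiteness of the Green function on the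
diagonal, and transience follows from the maximum principle `greenSum_le_diag`.
-/

namespace HypergeometricRWRE

/-! ### Integration over the simplex and the duality of hypergeometric functions -/

section Duality

variable {ι κ : Type*} [Fintype ι] [Fintype κ]

section Polar

variable [DecidableEq ι]

lemma lintegral_simplexVolume (i₀ : ι) (f : (ι → ℝ) → ℝ≥0∞) (hf : Measurable f) :
    ∫⁻ u, f u.1 ∂(simplexVolume i₀)
      = ∫⁻ v, (openSimplex ι).indicator f (completeCoord i₀ v) := by
  rw [simplexVolume, ← lintegral_map (hf.indicator measurableSet_simplex)
      (continuous_completeCoord i₀).measurable, lintegral_indicator measurableSet_simplex,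
    lintegral_subtype_comap measurableSet_simplex]

instance (i₀ : ι) : SFinite (simplexVolume i₀) := by
  have := (measurableEmbedding_completeCoord i₀).sigmaFinite_map
    (μ := (volume : Measure ({i // i ≠ i₀} → ℝ)))
  have hval := MeasurableEmbedding.subtype_coe (measurableSet_simplex (ι := ι))
  set ν := (volume : Measure ({i // i ≠ i₀} → ℝ)).map (completeCoord i₀) with hν
  refine ⟨fun n => (sfiniteSeq ν n).comap Subtype.val, fun n => ⟨?_⟩, ?_⟩
  · rw [hval.comap_apply]
    exact measure_lt_top _ _
  · refine Measure.ext fun s hs => ?_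
    rw [simplexVolume, ← hν, hval.comap_apply, Measure.sum_apply _ hs]
    conv_lhs => rw [← sum_sfiniteSeq ν]
    rw [Measure.sum_apply _ (hval.measurableSet_image.2 hs)]
    exact tsum_congr fun n => (hval.comap_apply _ _).symm

/-- The vector with coordinate `s` at `i₀` and the coordinates `w` elsewhere. -/
def extendCoord {ι : Type*} [DecidableEq ι] (i₀ : ι) (s : ℝ) (w : {i // i ≠ i₀} → ℝ) : ι → ℝ :=
  fun i => if h : i = i₀ then s else w ⟨i, h⟩

lemma measurable_extendCoord {ι : Type*} [DecidableEq ι] (i₀ : ι) :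
    Measurable fun p : ℝ × ({i // i ≠ i₀} → ℝ) => extendCoord i₀ p.1 p.2 := by
  refine measurable_pi_lambda _ fun i => ?_
  by_cases h : i = i₀
  · simp only [extendCoord, h, dite_true]; fun_prop
  · simp only [extendCoord, h, dite_false]; fun_prop

lemma lintegral_eq_extendCoord (i₀ : ι) (f : (ι → ℝ) → ℝ≥0∞) (hf : Measurable f) :
    ∫⁻ x, f x = ∫⁻ w : {i // i ≠ i₀} → ℝ, ∫⁻ s, f (extendCoord i₀ s w) := by
  have h1 := (volume_preserving_piEquivPiSubtypeProd (fun _ : ι => ℝ) (fun i => i = i₀)).symm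
  have h2 := (volume_preserving_funUnique {i : ι // i = i₀} ℝ).symm
  rw [← h1.lintegral_comp hf, Measure.volume_eq_prod]
  refine (lintegral_prod_symm _ (hf.comp (MeasurableEquiv.measurable _)).aemeasurable).trans ?_
  refine lintegral_congr fun w => ?_
  have hm : Measurable fun x : {i // i = i₀} → ℝ =>
      f ((MeasurableEquiv.piEquivPiSubtypeProd (fun _ : ι => ℝ) fun i => i = i₀).symm (x, w)) :=
    hf.comp ((MeasurableEquiv.measurable _).comp (measurable_id.prodMk measurable_const))
  refine Eq.trans (by congr!) ((h2.lintegral_comp hm).symm.trans ?_)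
  refine lintegral_congr fun s => ?_
  congr 1

lemma lintegral_pi_smul {κ : Type*} [Fintype κ] (f : (κ → ℝ) → ℝ≥0∞) (hf : Measurable f) {r : ℝ}
    (hr : 0 < r) : ∫⁻ w, f w = ENNReal.ofReal (r ^ Fintype.card κ) * ∫⁻ v, f (r • v) := by
  have h := Measure.map_addHaar_smul (volume : Measure (κ → ℝ)) hr.ne'
  rw [Module.finrank_pi, abs_of_pos (by positivity)] at h
  rw [← lintegral_map hf (measurable_const_smul r), h, lintegral_smul_measure, smul_eq_mul,
    ← mul_assoc, ← ENNReal.ofReal_mul (by positivity), mul_inv_cancel₀ (by positivity)]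
  simp

/-- Polar coordinates `x = r • u` with `r = ∑ x_i > 0` and `u` in the open simplex. -/
lemma lintegral_orthant_eq_polar (i₀ : ι) (f : (ι → ℝ) → ℝ≥0∞) (hf : Measurable f)
    (h0 : ∀ x, ¬ (∀ i, 0 < x i) → f x = 0) :
    ∫⁻ x, f x = ∫⁻ u : OpenSimplex ι, ∫⁻ r in Set.Ioi (0 : ℝ),
      ENNReal.ofReal (r ^ (Fintype.card ι - 1)) * f (r • u.1) ∂volume ∂(simplexVolume i₀) := by
  have hcard : Fintype.card {i // i ≠ i₀} = Fintype.card ι - 1 := by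
    simp
  have hg : Measurable fun p : (ι → ℝ) × ℝ =>
      ENNReal.ofReal (p.2 ^ (Fintype.card ι - 1)) * f (p.2 • p.1) := by
    refine Measurable.mul (by fun_prop) (hf.comp (by fun_prop))
  have hpos : ∀ x : ι → ℝ, (∀ i, 0 < x i) → 0 < ∑ i, x i := fun x hx =>
    Finset.sum_pos (fun i _ => hx i) ⟨i₀, Finset.mem_univ _⟩
  rw [lintegral_simplexVolume i₀ (fun u => ∫⁻ r in Set.Ioi (0 : ℝ),
      ENNReal.ofReal (r ^ (Fintype.card ι - 1)) * f (r • u)) hg.lintegral_prod_right',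
    lintegral_eq_extendCoord i₀ f hf]
  have hm1 : Measurable fun p : ({i // i ≠ i₀} → ℝ) × ℝ =>
      f (extendCoord i₀ (p.2 - ∑ j, p.1 j) p.1) :=
    hf.comp ((measurable_extendCoord i₀).comp
      (f := fun p : ({i // i ≠ i₀} → ℝ) × ℝ => (p.2 - ∑ j, p.1 j, p.1)) (by fun_prop))
  calc ∫⁻ w : {i // i ≠ i₀} → ℝ, ∫⁻ s, f (extendCoord i₀ s w)
      = ∫⁻ w : {i // i ≠ i₀} → ℝ, ∫⁻ r : ℝ, f (extendCoord i₀ (r - ∑ j, w j) w) := by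
        refine lintegral_congr fun w => ?_
        exact (lintegral_sub_right_eq_self (fun s => f (extendCoord i₀ s w)) _).symm
    _ = ∫⁻ r : ℝ, ∫⁻ w : {i // i ≠ i₀} → ℝ, f (extendCoord i₀ (r - ∑ j, w j) w) :=
        lintegral_lintegral_swap hm1.aemeasurable
    _ = ∫⁻ r in Set.Ioi (0 : ℝ), ∫⁻ w : {i // i ≠ i₀} → ℝ,
          f (extendCoord i₀ (r - ∑ j, w j) w) := by
        rw [← lintegral_indicator measurableSet_Ioi]
        refine lintegral_congr fun r => ?_
        by_cases hr : 0 < r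
        · rw [Set.indicator_of_mem (show r ∈ Set.Ioi (0 : ℝ) from hr)]
        · rw [Set.indicator_of_notMem (show r ∉ Set.Ioi (0 : ℝ) from hr)]
          refine lintegral_eq_zero_of_ae_eq_zero (Filter.Eventually.of_forall fun w => h0 _
            fun hx => hr ?_)
          have := hpos _ hx
          rw [Fintype.sum_eq_add_sum_subtype_ne _ i₀] at this
          have h2 : ∀ j : {i // i ≠ i₀}, extendCoord i₀ (r - ∑ j, w j) w j = w j := fun j => by
            simp [extendCoord, j.2]
          simp only [h2] at this
          simpa [extendCoord] using this
    _ = ∫⁻ r in Set.Ioi (0 : ℝ), ∫⁻ v : {i // i ≠ i₀} → ℝ,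
          ENNReal.ofReal (r ^ (Fintype.card ι - 1)) * f (r • completeCoord i₀ v) := by
        refine setLIntegral_congr_fun measurableSet_Ioi fun r (hr : 0 < r) => ?_
        have hm2 : Measurable fun w : {i // i ≠ i₀} → ℝ => f (extendCoord i₀ (r - ∑ j, w j) w) :=
          hm1.comp (measurable_id.prodMk measurable_const)
        rw [lintegral_pi_smul _ hm2 hr, hcard, ← lintegral_const_mul' _ _ ENNReal.ofReal_ne_top]
        refine lintegral_congr fun v => ?_
        congr 2
        funext i
        by_cases h : i = i₀
        · simp [extendCoord, completeCoord, h, mul_sub, Finset.mul_sum]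
        · simp [extendCoord, completeCoord, h]
    _ = ∫⁻ v : {i // i ≠ i₀} → ℝ, ∫⁻ r in Set.Ioi (0 : ℝ),
          ENNReal.ofReal (r ^ (Fintype.card ι - 1)) * f (r • completeCoord i₀ v) := by
        refine lintegral_lintegral_swap (Measurable.aemeasurable ?_)
        have := (continuous_completeCoord i₀).measurable
        exact hg.comp (f := fun p : ℝ × ({i // i ≠ i₀} → ℝ) => (completeCoord i₀ p.2, p.1))
          (by fun_prop)
    _ = _ := by
        refine lintegral_congr fun v => ?_
        by_cases hv : completeCoord i₀ v ∈ openSimplex ι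
        · rw [Set.indicator_of_mem hv]
        · rw [Set.indicator_of_notMem hv]
          refine lintegral_eq_zero_of_ae_eq_zero ?_
          refine (ae_restrict_iff' measurableSet_Ioi).2 (Filter.Eventually.of_forall fun r hr => ?_)
          have : f (r • completeCoord i₀ v) = 0 :=
            h0 _ fun hx => hv ⟨fun i => ?_, sum_completeCoord _ _⟩
          · simp [this]
          · exact pos_of_mul_pos_right (by simpa using hx i) (le_of_lt hr)

end Polar

lemma lintegral_ofReal_fintype_prod {f : κ → ℝ → ℝ} (h0 : ∀ k t, 0 ≤ f k t)
    (hf : ∀ k, Integrable (f k)) :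
    ∫⁻ x : κ → ℝ, ∏ k, ENNReal.ofReal (f k (x k)) = ∏ k, ∫⁻ t, ENNReal.ofReal (f k t) := by
  have h1 : ∀ x : κ → ℝ, ∏ k, ENNReal.ofReal (f k (x k)) = ENNReal.ofReal (∏ k, f k (x k)) :=
    fun x => (ENNReal.ofReal_prod_of_nonneg fun k _ => h0 k _).symm
  simp only [h1]
  rw [volume_pi, ← ofReal_integral_eq_lintegral_ofReal (Integrable.fintype_prod hf)
    (Filter.Eventually.of_forall fun x => Finset.prod_nonneg fun k _ => h0 k _),
    integral_fintype_prod_eq_prod,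
    ENNReal.ofReal_prod_of_nonneg fun k _ => integral_nonneg (h0 k)]
  exact Finset.prod_congr rfl fun k _ =>
    ofReal_integral_eq_lintegral_ofReal (hf k) (Filter.Eventually.of_forall (h0 k))

lemma integrableOn_rpow_mul_exp {b y : ℝ} (hb : 0 < b) (hy : 0 < y) :
    IntegrableOn (fun t => t ^ (b - 1) * Real.exp (-(y * t))) (Set.Ioi 0) := by
  simpa using integrableOn_rpow_mul_exp_neg_mul_rpow (p := 1) (s := b - 1) (b := y)
    (by linarith) one_pos hy

lemma lintegral_rpow_mul_exp {b y : ℝ} (hb : 0 < b) (hy : 0 < y) :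
    ∫⁻ t in Set.Ioi (0 : ℝ), ENNReal.ofReal (t ^ (b - 1) * Real.exp (-(y * t)))
      = ENNReal.ofReal (Real.Gamma b * y ^ (-b)) := by
  rw [← ofReal_integral_eq_lintegral_ofReal]
  · rw [Real.integral_rpow_mul_exp_neg_mul_Ioi hb hy, one_div, Real.inv_rpow hy.le,
      Real.rpow_neg hy.le, mul_comm]
  · exact integrableOn_rpow_mul_exp hb hy
  · refine (ae_restrict_iff' measurableSet_Ioi).2 (Filter.Eventually.of_forall fun t ht => ?_)
    exact mul_nonneg (Real.rpow_nonneg (le_of_lt ht) _) (Real.exp_pos _).le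

/-- Feynman's parametrization of a product of negative powers. -/
lemma gamma_mul_prod_rpow_neg [DecidableEq κ] (k₀ : κ) {b y : κ → ℝ} (hb : ∀ k, 0 < b k)
    (hy : ∀ k, 0 < y k) :
    ENNReal.ofReal ((∏ k, Real.Gamma (b k)) * ∏ k, y k ^ (-b k))
      = ENNReal.ofReal (Real.Gamma (∑ k, b k)) *
        ∫⁻ v : OpenSimplex κ, ENNReal.ofReal ((∏ k, v.1 k ^ (b k - 1)) *
          (∑ k, y k * v.1 k) ^ (-∑ k, b k)) ∂(simplexVolume k₀) := by
  have hne : (Finset.univ : Finset κ).Nonempty := ⟨k₀, Finset.mem_univ _⟩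
  let g : κ → ℝ → ℝ≥0∞ := fun k => (Set.Ioi (0 : ℝ)).indicator fun t =>
    ENNReal.ofReal (t ^ (b k - 1) * Real.exp (-(y k * t)))
  have hgm : ∀ k, Measurable (g k) := fun k =>
    Measurable.indicator (by fun_prop) measurableSet_Ioi
  have hcard : 1 ≤ Fintype.card κ := Fintype.card_pos_iff.2 ⟨k₀⟩
  have h1 : ∫⁻ x : κ → ℝ, ∏ k, g k (x k)
      = ENNReal.ofReal ((∏ k, Real.Gamma (b k)) * ∏ k, y k ^ (-b k)) := by
    have hgr : ∀ k, g k = fun t => ENNReal.ofReal ((Set.Ioi (0 : ℝ)).indicator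
        (fun t => t ^ (b k - 1) * Real.exp (-(y k * t))) t) := fun k => by
      funext t
      by_cases ht : t ∈ Set.Ioi (0 : ℝ) <;> simp only [g, ht, Set.indicator_of_mem,
        Set.indicator_of_notMem, not_false_eq_true, ENNReal.ofReal_zero]
    have hprod : ∫⁻ x : κ → ℝ, ∏ k, g k (x k) = ∏ k, ∫⁻ t, g k t := by
      simp only [hgr]
      refine lintegral_ofReal_fintype_prod (fun k t => Set.indicator_nonneg (fun t ht =>
        mul_nonneg (Real.rpow_nonneg (le_of_lt ht) _) (Real.exp_pos _).le) t) fun k => ?_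
      exact (integrable_indicator_iff measurableSet_Ioi).2 (integrableOn_rpow_mul_exp (hb k) (hy k))
    rw [hprod, ← Finset.prod_mul_distrib, ENNReal.ofReal_prod_of_nonneg fun k _ =>
        mul_nonneg (Real.Gamma_pos_of_pos (hb k)).le (Real.rpow_nonneg (hy k).le _)]
    refine Finset.prod_congr rfl fun k _ => ?_
    rw [lintegral_indicator measurableSet_Ioi, lintegral_rpow_mul_exp (hb k) (hy k)]
  rw [← h1, lintegral_orthant_eq_polar k₀, ← lintegral_const_mul]
  · refine lintegral_congr fun v => ?_
    have hS : 0 < ∑ k, y k * v.1 k := Finset.sum_pos (fun k _ => mul_pos (hy k) (v.2.1 k)) hne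
    have hB : 0 < ∑ k, b k := Finset.sum_pos (fun k _ => hb k) hne
    have hP : 0 ≤ ∏ k, v.1 k ^ (b k - 1) :=
      Finset.prod_nonneg fun k _ => Real.rpow_nonneg (v.2.1 k).le _
    have h2 : ∀ r ∈ Set.Ioi (0 : ℝ),
        ENNReal.ofReal (r ^ (Fintype.card κ - 1)) * ∏ k, g k ((r • v.1) k)
          = ENNReal.ofReal (∏ k, v.1 k ^ (b k - 1)) * ENNReal.ofReal
            (r ^ (∑ k, b k - 1) * Real.exp (-((∑ k, y k * v.1 k) * r))) := by
      intro r (hr : 0 < r)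
      have h3 : ∏ k, g k ((r • v.1) k) = ENNReal.ofReal (∏ k, ((r * v.1 k) ^ (b k - 1) *
          Real.exp (-(y k * (r * v.1 k))))) := by
        rw [ENNReal.ofReal_prod_of_nonneg fun k _ => mul_nonneg
          (Real.rpow_nonneg (mul_pos hr (v.2.1 k)).le _) (Real.exp_pos _).le]
        refine Finset.prod_congr rfl fun k _ => ?_
        simp only [g, Pi.smul_apply, smul_eq_mul]
        rw [Set.indicator_of_mem (show r * v.1 k ∈ Set.Ioi (0 : ℝ) from mul_pos hr (v.2.1 k))]
      rw [h3, ← ENNReal.ofReal_mul (by positivity), ← ENNReal.ofReal_mul hP]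
      congr 1
      rw [Finset.prod_mul_distrib, ← Real.exp_sum]
      have h4 : ∏ k, (r * v.1 k) ^ (b k - 1)
          = r ^ (∑ k, (b k - 1)) * ∏ k, v.1 k ^ (b k - 1) := by
        rw [Real.rpow_sum_of_pos hr, ← Finset.prod_mul_distrib]
        exact Finset.prod_congr rfl fun k _ => Real.mul_rpow hr.le (v.2.1 k).le
      have h5 : ∑ k, -(y k * (r * v.1 k)) = -((∑ k, y k * v.1 k) * r) := by
        rw [Finset.sum_neg_distrib, Finset.sum_mul]
        congr 1
        exact Finset.sum_congr rfl fun k _ => by ring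
      have h6 : r ^ (Fintype.card κ - 1) * r ^ (∑ k, (b k - 1)) = r ^ (∑ k, b k - 1) := by
        rw [← Real.rpow_natCast, ← Real.rpow_add hr]
        congr 1
        rw [Finset.sum_sub_distrib]
        push_cast [Nat.cast_sub hcard]
        simp
      rw [h4, h5, ← h6]
      ring
    rw [setLIntegral_congr_fun measurableSet_Ioi h2, lintegral_const_mul _ (by fun_prop),
      lintegral_rpow_mul_exp hB hS, ← ENNReal.ofReal_mul hP,
      ← ENNReal.ofReal_mul (Real.Gamma_pos_of_pos hB).le]
    congr 1
    ring
  · have : Measurable fun v : κ → ℝ => ENNReal.ofReal ((∏ k, v k ^ (b k - 1)) *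
          (∑ k, y k * v k) ^ (-∑ k, b k)) := by
      refine ENNReal.measurable_ofReal.comp (Measurable.mul ?_ ?_)
      · exact Finset.measurable_prod _ fun i _ => by fun_prop
      · refine Measurable.pow_const ?_ _
        fun_prop
    exact this.comp measurable_subtype_coe
  · exact Finset.measurable_prod _ fun k _ => (hgm k).comp (measurable_pi_apply k)
  · intro x hx
    push Not at hx
    obtain ⟨k, hk⟩ := hx
    refine Finset.prod_eq_zero (Finset.mem_univ k) ?_
    exact Set.indicator_of_notMem (by simpa using hk) _

/-- The hypergeometric function `Φ(a, b; Z)`, as an integral with values in `[0, ∞]`. -/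
noncomputable def hyperInt [DecidableEq ι] (i₀ : ι) (a : ι → ℝ) (b : κ → ℝ) (Z : Matrix κ ι ℝ) :
    ℝ≥0∞ :=
  ∫⁻ u, ENNReal.ofReal (phi a b Z u) ∂(simplexVolume i₀)

lemma mulVec_pos {κ : Type*} {Z : Matrix κ ι ℝ} (hZ : ∀ j i, 0 < Z j i) (u : OpenSimplex ι)
    (j : κ) : 0 < (Z *ᵥ u.1) j := by
  have : Nonempty ι := by
    by_contra h
    rw [not_nonempty_iff] at h
    simpa using u.2.2
  simp only [Matrix.mulVec, dotProduct]
  exact Finset.sum_pos (fun i _ => mul_pos (hZ j i) (u.2.1 i)) Finset.univ_nonempty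

lemma measurable_phi (a : ι → ℝ) (b : κ → ℝ) (Z : Matrix κ ι ℝ) : Measurable (phi a b Z) := by
  have hGm : Measurable fun u : ι → ℝ => (∏ i, u i ^ (a i - 1)) * ∏ j, (Z *ᵥ u) j ^ (-b j) := by
    refine Measurable.mul ?_ ?_
    · exact Finset.measurable_prod _ fun i _ => by fun_prop
    · refine Finset.measurable_prod _ fun j _ => ?_
      have : Measurable fun u : ι → ℝ => (Z *ᵥ u) j := by
        simp only [Matrix.mulVec, dotProduct]; fun_prop
      exact this.pow_const _
  exact hGm.comp measurable_subtype_coe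

lemma phi_nonneg {a : ι → ℝ} {b : κ → ℝ} {Z : Matrix κ ι ℝ} (hZ : ∀ j i, 0 < Z j i)
    (u : OpenSimplex ι) : 0 ≤ phi a b Z u :=
  mul_nonneg (Finset.prod_nonneg fun i _ => Real.rpow_nonneg (u.2.1 i).le _)
    (Finset.prod_nonneg fun j _ => Real.rpow_nonneg (mulVec_pos hZ u j).le _)

lemma hyperInt_ne_top [DecidableEq ι] (i₀ : ι) {a : ι → ℝ} {b : κ → ℝ} {Z : Matrix κ ι ℝ}
    (ha : ∀ i, 0 < a i) (hb : ∀ j, 0 < b j) (hZ : ∀ j i, 0 < Z j i) :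
    hyperInt i₀ a b Z ≠ ∞ :=
  (integrable_phi i₀ ha hb hZ).lintegral_lt_top.ne

lemma ofReal_Phi [DecidableEq ι] (i₀ : ι) {a : ι → ℝ} {b : κ → ℝ} {Z : Matrix κ ι ℝ}
    (ha : ∀ i, 0 < a i) (hb : ∀ j, 0 < b j) (hZ : ∀ j i, 0 < Z j i) :
    ENNReal.ofReal (Phi i₀ a b Z) = hyperInt i₀ a b Z :=
  ofReal_integral_eq_lintegral_ofReal (integrable_phi i₀ ha hb hZ)
    (Filter.Eventually.of_forall fun u => phi_nonneg hZ u)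

lemma hyperInt_ne_zero [DecidableEq ι] (i₀ : ι) {a : ι → ℝ} {b : κ → ℝ} {Z : Matrix κ ι ℝ}
    (hZ : ∀ j i, 0 < Z j i) : hyperInt i₀ a b Z ≠ 0 := by
  have : Nonempty ι := ⟨i₀⟩
  intro h
  rw [hyperInt, lintegral_eq_zero_iff (measurable_phi a b Z).ennreal_ofReal] at h
  have h2 : ∀ᵐ u ∂(simplexVolume i₀), False := h.mono fun u hu => by
    have := phi_pos (α := a) (β := b) hZ u
    simp only [Pi.zero_apply, ENNReal.ofReal_eq_zero] at hu
    linarith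
  rw [Filter.eventually_false_iff_eq_bot, ae_eq_bot] at h2
  have h3 := simplexVolume_univ_pos i₀
  rw [h2] at h3
  simp at h3

/-- Feynman's parametrization turns `Φ(a, b; Z)` into a double integral in which the two families of
parameters enter symmetrically. -/
lemma gamma_mul_hyperInt [DecidableEq ι] [DecidableEq κ] (i₀ : ι) (k₀ : κ) {a : ι → ℝ} {b : κ → ℝ}
    {Z : Matrix κ ι ℝ} (hb : ∀ j, 0 < b j) (hZ : ∀ j i, 0 < Z j i) :
    ENNReal.ofReal (∏ k, Real.Gamma (b k)) * hyperInt i₀ a b Z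
      = ENNReal.ofReal (Real.Gamma (∑ k, b k)) *
        ∫⁻ u : OpenSimplex ι, ∫⁻ v : OpenSimplex κ, ENNReal.ofReal ((∏ i, u.1 i ^ (a i - 1)) *
          (∏ k, v.1 k ^ (b k - 1)) * (∑ k, ∑ i, v.1 k * Z k i * u.1 i) ^ (-∑ k, b k))
          ∂(simplexVolume k₀) ∂(simplexVolume i₀) := by
  have hm : Measurable fun p : (ι → ℝ) × (κ → ℝ) => ENNReal.ofReal ((∏ i, p.1 i ^ (a i - 1)) *
      (∏ k, p.2 k ^ (b k - 1)) * (∑ k, ∑ i, p.2 k * Z k i * p.1 i) ^ (-∑ k, b k)) := by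
    refine ENNReal.measurable_ofReal.comp (Measurable.mul (Measurable.mul ?_ ?_) ?_)
    · exact Finset.measurable_prod _ fun i _ => by fun_prop
    · exact Finset.measurable_prod _ fun i _ => by fun_prop
    · refine Measurable.pow_const ?_ _
      fun_prop
  have hm' : Measurable fun p : OpenSimplex ι × OpenSimplex κ =>
      ENNReal.ofReal ((∏ i, p.1.1 i ^ (a i - 1)) * (∏ k, p.2.1 k ^ (b k - 1)) *
        (∑ k, ∑ i, p.2.1 k * Z k i * p.1.1 i) ^ (-∑ k, b k)) :=
    hm.comp (f := fun p : OpenSimplex ι × OpenSimplex κ => (p.1.1, p.2.1)) (by fun_prop)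
  rw [hyperInt, ← lintegral_const_mul _ (measurable_phi a b Z).ennreal_ofReal,
    ← lintegral_const_mul _ hm'.lintegral_prod_right']
  refine lintegral_congr fun u => ?_
  have hu : 0 ≤ ∏ i, u.1 i ^ (a i - 1) :=
    Finset.prod_nonneg fun i _ => Real.rpow_nonneg (u.2.1 i).le _
  have hG : 0 ≤ ∏ k, Real.Gamma (b k) :=
    Finset.prod_nonneg fun k _ => (Real.Gamma_pos_of_pos (hb k)).le
  have h := gamma_mul_prod_rpow_neg k₀ hb fun k => mulVec_pos hZ u k
  rw [← ENNReal.ofReal_mul hG, phi, mul_left_comm, ENNReal.ofReal_mul hu, h, mul_left_comm,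
    ← lintegral_const_mul' _ _ ENNReal.ofReal_ne_top]
  congr 1
  refine lintegral_congr fun v => ?_
  rw [← ENNReal.ofReal_mul hu, ← mul_assoc]
  congr 3
  refine Finset.sum_congr rfl fun k _ => ?_
  simp only [Matrix.mulVec, dotProduct, Finset.sum_mul]
  exact Finset.sum_congr rfl fun i _ => by ring

/-- Duality: if `∑ a = ∑ b` then `Φ(a, b; Z) / ∏ Γ(a) = Φ(b, a; Zᵀ) / ∏ Γ(b)`. Both sides are, up to
the factor `Γ(∑ a)`, the integral of `∏ u ^ (a - 1) ∏ v ^ (b - 1) (v · Z u) ^ (-∑ a)` over a product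
of two simplices. -/
theorem hyperInt_duality [DecidableEq ι] [DecidableEq κ] (i₀ : ι) (k₀ : κ) {a : ι → ℝ} {b : κ → ℝ}
    {Z : Matrix κ ι ℝ} (ha : ∀ i, 0 < a i) (hb : ∀ j, 0 < b j) (hZ : ∀ j i, 0 < Z j i)
    (hab : ∑ i, a i = ∑ k, b k) :
    ENNReal.ofReal (∏ k, Real.Gamma (b k)) * hyperInt i₀ a b Z
      = ENNReal.ofReal (∏ i, Real.Gamma (a i)) * hyperInt k₀ b a Zᵀ := by
  rw [gamma_mul_hyperInt i₀ k₀ hb hZ, gamma_mul_hyperInt k₀ i₀ (Z := Zᵀ) ha (fun i j => hZ j i),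
    hab]
  congr 1
  rw [lintegral_lintegral_swap]
  · refine lintegral_congr fun v => lintegral_congr fun u => ?_
    congr 1
    rw [mul_comm (∏ i, u.1 i ^ (a i - 1)), Finset.sum_comm]
    congr 2
    exact Finset.sum_congr rfl fun i _ => Finset.sum_congr rfl fun k _ => by
      rw [Matrix.transpose_apply]; ring
  · have hm : Measurable fun p : (ι → ℝ) × (κ → ℝ) => ENNReal.ofReal ((∏ i, p.1 i ^ (a i - 1)) *
        (∏ k, p.2 k ^ (b k - 1)) * (∑ k, ∑ i, p.2 k * Z k i * p.1 i) ^ (-∑ k, b k)) := by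
      refine ENNReal.measurable_ofReal.comp (Measurable.mul (Measurable.mul ?_ ?_) ?_)
      · exact Finset.measurable_prod _ fun i _ => by fun_prop
      · exact Finset.measurable_prod _ fun i _ => by fun_prop
      · refine Measurable.pow_const ?_ _
        fun_prop
    exact (hm.comp (f := fun p : OpenSimplex ι × OpenSimplex κ => (p.1.1, p.2.1))
      (by fun_prop)).aemeasurable

end Duality

/-! ### Green functions as sums over paths -/

section Paths

variable {V : Type*}

/-- The list of arcs of a path started at `e`. Paths are lists of the states visited after `e`, the
last one first. -/
def arcs (e : V) : List V → List (V × V)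
  | [] => []
  | f :: l => (l.headD e, f) :: arcs e l

/-- The product of the arc weights `M` along a path started at `e`. -/
noncomputable def pathWeight (M : V → V → ℝ≥0∞) (e : V) (l : List V) : ℝ≥0∞ :=
  ((arcs e l).map fun a => M a.1 a.2).prod

lemma pathWeight_nil (M : V → V → ℝ≥0∞) (e : V) : pathWeight M e [] = 1 := by
  simp [pathWeight, arcs]

lemma pathWeight_cons (M : V → V → ℝ≥0∞) (e f : V) (l : List V) :
    pathWeight M e (f :: l) = M (l.headD e) f * pathWeight M e l := by
  simp [pathWeight, arcs]

lemma tsum_list (F : List V → ℝ≥0∞) : ∑' l, F l = F [] + ∑' f, ∑' l, F (f :: l) := by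
  let φ : Unit ⊕ (V × List V) ≃ List V :=
    { toFun := fun x => match x with
        | .inl _ => []
        | .inr p => p.1 :: p.2
      invFun := fun l => match l with
        | [] => .inl ()
        | f :: l => .inr (f, l)
      left_inv := by rintro (_ | ⟨f, l⟩) <;> rfl
      right_inv := by rintro (_ | ⟨f, l⟩) <;> rfl }
  rw [← φ.tsum_eq F, ENNReal.summable.tsum_sum ENNReal.summable, ENNReal.tsum_prod']
  simp [φ]

variable [DecidableEq V]

/-- The weight of the paths from `e` to `f`, of arbitrary length. -/
noncomputable def greenSum (M : V → V → ℝ≥0∞) (e f : V) : ℝ≥0∞ :=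
  ∑' l : List V, if l.headD e = f then pathWeight M e l else 0

/-- The weight of the paths of length `n` from `e` to `f`. -/
noncomputable def stepSum (M : V → V → ℝ≥0∞) (e : V) : ℕ → V → ℝ≥0∞
  | 0 => fun f => if e = f then 1 else 0
  | n + 1 => fun f => ∑' g, stepSum M e n g * M g f

lemma stepSum_eq_tsum_list (M : V → V → ℝ≥0∞) (e : V) (n : ℕ) (f : V) :
    stepSum M e n f
      = ∑' l : List V, if l.length = n ∧ l.headD e = f then pathWeight M e l else 0 := by
  induction n generalizing f with
  | zero =>
    rw [tsum_list]
    simp [stepSum, pathWeight_nil]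
  | succ n ih =>
    rw [tsum_list]
    simp only [stepSum, ih, List.length_nil, List.length_cons, Nat.add_right_cancel_iff,
      List.headD_cons, pathWeight_cons]
    simp only [← ENNReal.tsum_mul_right]
    rw [ENNReal.tsum_comm]
    rw [if_neg (by simp), zero_add, tsum_eq_single f]
    · refine tsum_congr fun l => ?_
      rw [tsum_eq_single (l.headD e)]
      · by_cases h : l.length = n <;> simp [h, mul_comm]
      · intro g hg
        rw [if_neg (fun h => hg h.2.symm), zero_mul]
    · intro g hg
      simp [hg]

lemma greenSum_eq_tsum_stepSum (M : V → V → ℝ≥0∞) (e f : V) :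
    greenSum M e f = ∑' n, stepSum M e n f := by
  simp only [stepSum_eq_tsum_list]
  rw [ENNReal.tsum_comm, greenSum]
  refine tsum_congr fun l => ?_
  rw [tsum_eq_single l.length]
  · simp
  · intro n hn
    rw [if_neg (fun h => hn h.1.symm)]

/-- The decomposition of a path according to its first step, instead of its last one. -/
lemma stepSum_succ' (M : V → V → ℝ≥0∞) (e : V) (n : ℕ) (f : V) :
    stepSum M e (n + 1) f = ∑' g, M e g * stepSum M g n f := by
  induction n generalizing f with
  | zero =>
    have h1 : stepSum M e 1 f = M e f := by
      simp only [stepSum]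
      rw [tsum_eq_single e (fun g hg => by simp [hg.symm])]
      simp
    rw [h1, tsum_eq_single f (fun g hg => by simp [stepSum, hg])]
    simp [stepSum]
  | succ n ih =>
    rw [stepSum]
    simp only [ih]
    simp only [stepSum, ← ENNReal.tsum_mul_left, ← ENNReal.tsum_mul_right]
    rw [ENNReal.tsum_comm]
    simp only [mul_assoc]

/-- The maximum principle for a Green function: it is largest on the diagonal. -/
lemma greenSum_le_diag {M : V → V → ℝ≥0∞} (hM : ∀ e, ∑' f, M e f ≤ 1) (e f : V) :
    greenSum M e f ≤ greenSum M f f := by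
  have key : ∀ N e, ∑ n ∈ Finset.range N, stepSum M e n f ≤ greenSum M f f := by
    intro N
    induction N with
    | zero => simp
    | succ N ih =>
      intro e
      by_cases h : e = f
      · subst h
        rw [greenSum_eq_tsum_stepSum]
        exact ENNReal.sum_le_tsum _
      · rw [Finset.sum_range_succ']
        have h0 : stepSum M e 0 f = 0 := by simp [stepSum, h]
        simp only [h0, add_zero, stepSum_succ']
        rw [← Summable.tsum_finsetSum fun _ _ => ENNReal.summable]
        simp only [← Finset.mul_sum]
        calc ∑' g, M e g * ∑ n ∈ Finset.range N, stepSum M g n f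
            ≤ ∑' g, M e g * greenSum M f f := ENNReal.tsum_le_tsum fun g => by gcongr; exact ih g
          _ = (∑' g, M e g) * greenSum M f f := ENNReal.tsum_mul_right
          _ ≤ 1 * greenSum M f f := by gcongr; exact hM e
          _ = _ := one_mul _
  rw [greenSum_eq_tsum_stepSum M e f]
  exact ENNReal.tsum_le_of_sum_range_le fun N => key N e

/-- If the columns of `M` have sum at most `1`, and at most `x` for the column of `e`, then the
Green function at `e` is at most that of a geometric number of returns. -/
lemma greenSum_self_le {M : V → V → ℝ≥0∞} {e : V} {x : ℝ≥0∞} (hx : x < 1)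
    (hM : ∀ f, ∑' g, M g f ≤ if f = e then x else 1) : greenSum M e e ≤ (1 - x)⁻¹ := by
  have h1x : 1 - x ≠ 0 := (tsub_pos_of_lt hx).ne'
  have h1x' : 1 - x ≠ ∞ := (tsub_le_self.trans_lt ENNReal.one_lt_top).ne
  have key : ∀ N f, ∑ n ∈ Finset.range N, stepSum M e n f ≤ (1 - x)⁻¹ := by
    intro N
    induction N with
    | zero => simp
    | succ N ih =>
      intro f
      rw [Finset.sum_range_succ']
      have h2 : ∑ n ∈ Finset.range N, stepSum M e (n + 1) f
          ≤ (1 - x)⁻¹ * if f = e then x else 1 := by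
        simp only [stepSum]
        rw [← Summable.tsum_finsetSum fun _ _ => ENNReal.summable]
        simp only [← Finset.sum_mul]
        calc ∑' g, (∑ n ∈ Finset.range N, stepSum M e n g) * M g f
            ≤ ∑' g, (1 - x)⁻¹ * M g f := ENNReal.tsum_le_tsum fun g => by gcongr; exact ih g
          _ = (1 - x)⁻¹ * ∑' g, M g f := ENNReal.tsum_mul_left
          _ ≤ _ := by gcongr; exact hM f
      refine (add_le_add_left h2 _).trans ?_
      by_cases h : f = e
      · subst h
        rw [if_pos rfl]
        simp only [stepSum, if_true]
        calc (1 - x)⁻¹ * x + 1 = (1 - x)⁻¹ * x + (1 - x)⁻¹ * (1 - x) := by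
              rw [ENNReal.inv_mul_cancel h1x h1x']
          _ = (1 - x)⁻¹ * (x + (1 - x)) := by rw [mul_add]
          _ ≤ (1 - x)⁻¹ := by rw [add_tsub_cancel_of_le hx.le, mul_one]
      · simp [stepSum, h, Ne.symm h]
  rw [greenSum_eq_tsum_stepSum]
  exact ENNReal.tsum_le_of_sum_range_le fun N => key N e

/-- Conservation along a path: each state is left as often as it is entered, up to the two
endpoints. -/
lemma count_arcs [BEq V] [LawfulBEq V] (e g : V) (l : List V) :
    ((arcs e l).map Prod.fst).count g + (if l.headD e = g then 1 else 0)
      = ((arcs e l).map Prod.snd).count g + (if e = g then 1 else 0) := by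
  induction l with
  | nil => simp [arcs]
  | cons f l ih =>
    simp only [arcs, List.map_cons, List.count_cons, List.headD_cons, beq_iff_eq]
    by_cases h : f = g <;> simp only [h, if_true, if_false] <;> omega

lemma tsum_pow_eq_tsum_prod {α : Type*} (F : α → ℝ≥0∞) (q : ℕ) :
    (∑' a, F a) ^ q = ∑' L : Fin q → α, ∏ k, F (L k) := by
  induction q with
  | zero => simp
  | succ q ih =>
    rw [pow_succ', ih, ← (Fin.consEquiv fun _ : Fin (q + 1) => α).tsum_eq, ENNReal.tsum_prod',
      ← ENNReal.tsum_mul_right]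
    refine tsum_congr fun a => ?_
    rw [← ENNReal.tsum_mul_left]
    refine tsum_congr fun L => ?_
    simp [Fin.prod_univ_succ, Fin.consEquiv]

/-- The arcs of a family of paths started at `e`. -/
def multiArcs {q : ℕ} (e : V) (L : Fin q → List V) : List (V × V) :=
  (List.ofFn fun k => arcs e (L k)).flatten

omit [DecidableEq V] in
lemma prod_pathWeight {q : ℕ} (M : V → V → ℝ≥0∞) (e : V) (L : Fin q → List V) :
    ∏ k, pathWeight M e (L k) = ((multiArcs e L).map fun a => M a.1 a.2).prod := by
  rw [multiArcs, List.map_flatten, List.prod_flatten, List.map_ofFn, List.map_ofFn,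
    List.prod_ofFn]
  rfl

lemma count_multiArcs [BEq V] [LawfulBEq V] {q : ℕ} (e g : V) (L : Fin q → List V)
    (hL : ∀ k, (L k).headD e = e) :
    ((multiArcs e L).map Prod.fst).count g = ((multiArcs e L).map Prod.snd).count g := by
  rw [multiArcs, List.map_flatten, List.map_flatten, List.count_flatten, List.count_flatten,
    List.map_ofFn, List.map_ofFn, List.map_ofFn, List.map_ofFn]
  congr 2
  funext k
  have := count_arcs e g (L k)
  rw [hL k] at this
  simpa using this

/-- A power of the Green function as a sum over tuples of loops. -/
lemma greenSum_pow (M : V → V → ℝ≥0∞) (e : V) (q : ℕ) :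
    greenSum M e e ^ q = ∑' L : Fin q → List V, if ∀ k, (L k).headD e = e then
      ((multiArcs e L).map fun a => M a.1 a.2).prod else 0 := by
  rw [greenSum, tsum_pow_eq_tsum_prod]
  refine tsum_congr fun L => ?_
  by_cases h : ∀ k, (L k).headD e = e
  · rw [if_pos h, ← prod_pathWeight]
    exact Finset.prod_congr rfl fun k _ => by rw [if_pos (h k)]
  · rw [if_neg h]
    push Not at h
    obtain ⟨k, hk⟩ := h
    exact Finset.prod_eq_zero (Finset.mem_univ k) (if_neg hk)

end Paths

/-! ### The Green function of the quenched walk -/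

section Quenched

variable {d : ℕ}

/-- The transition matrix of the quenched walk. -/
noncomputable def transition (ω : Environment d) (e f : Edge d) : ℝ≥0∞ :=
  if f.1 = head e then ENNReal.ofReal ((ω e).1 f.2) else 0

lemma stepKernel_singleton (ω : Environment d) (e f : Edge d) :
    stepKernel ω e {f} = transition ω e f := by
  have h : (stepKernel ω) e = ∑ j, ENNReal.ofReal ((ω e).1 j) • Measure.dirac (head e, j) := rfl
  rw [h, Measure.finsetSum_apply, transition]
  simp only [Measure.smul_apply, smul_eq_mul, Measure.dirac_apply' _ (measurableSet_singleton f)]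
  by_cases hf : f.1 = head e
  · rw [if_pos hf, Finset.sum_eq_single f.2]
    · have : (head e, f.2) = f := by rw [← hf]
      simp [this]
    · intro j _ hj
      have : (head e, j) ≠ f := fun h => hj (by rw [← h])
      simp [this]
    · simp
  · rw [if_neg hf]
    refine Finset.sum_eq_zero fun j _ => ?_
    have : (head e, j) ≠ f := fun h => hf (by rw [← h])
    simp [this]

lemma tsum_transition (ω : Environment d) (e : Edge d) : ∑' f, transition ω e f = 1 := by
  simp only [← stepKernel_singleton]
  have := lintegral_countable' (μ := stepKernel ω e) (fun _ => 1)
  simpa using this.symm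

lemma quenchedLaw_succ (ω : Environment d) (e f : Edge d) (n : ℕ) :
    quenchedLaw ω e {X | X (n + 1) = f}
      = ∫⁻ X, transition ω (X n) f ∂(quenchedLaw ω e) := by
  let K : (n : ℕ) → Kernel (Finset.Iic n → Edge d) (Edge d) := fun n => (stepKernel ω).comap
      (fun h : (Finset.Iic n → Edge d) => h ⟨n, Finset.mem_Iic.2 le_rfl⟩) (measurable_pi_apply _)
  have hK := Kernel.partialTraj_compProd_eq_map_traj (X := fun _ => Edge d) (κ := K)
    (Nat.zero_le n) (x₀ := fun _ => e)
  have hs : MeasurableSet {p : (Finset.Iic n → Edge d) × Edge d | p.2 = f} :=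
    measurable_snd (measurableSet_singleton f)
  have hm : Measurable fun X : ℕ → Edge d =>
      (Preorder.frestrictLe (π := fun _ => Edge d) n X, X (n + 1)) := by
    fun_prop
  have h1 : quenchedLaw ω e {X | X (n + 1) = f}
      = ((Kernel.traj (X := fun _ => Edge d) K 0 fun _ => e).map
        (fun X => (Preorder.frestrictLe (π := fun _ => Edge d) n X, X (n + 1)))) {p | p.2 = f} := by
    rw [Measure.map_apply hm hs]
    rfl
  rw [h1, ← hK, Measure.compProd_apply hs, ← Kernel.traj_map_frestrictLe_apply,
    lintegral_map (Kernel.measurable_kernel_prodMk_left hs) (Preorder.measurable_frestrictLe n)]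
  refine lintegral_congr fun X => ?_
  rw [← stepKernel_singleton]
  rfl

lemma quenchedLaw_eq_stepSum (ω : Environment d) (e : Edge d) (n : ℕ) (f : Edge d) :
    quenchedLaw ω e {X | X n = f} = stepSum (transition ω) e n f := by
  induction n generalizing f with
  | zero =>
    let K : (n : ℕ) → Kernel (Finset.Iic n → Edge d) (Edge d) := fun n => (stepKernel ω).comap
      (fun h : (Finset.Iic n → Edge d) => h ⟨n, Finset.mem_Iic.2 le_rfl⟩) (measurable_pi_apply _)
    have h0 := Kernel.traj_map_frestrictLe_apply (X := fun _ => Edge d) (κ := K) 0 0 (fun _ => e)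
    rw [Kernel.partialTraj_self, Kernel.id_apply] at h0
    have hs : MeasurableSet {p : Finset.Iic 0 → Edge d | p ⟨0, Finset.mem_Iic.2 le_rfl⟩ = f} := by
      have h : Measurable fun p : Finset.Iic 0 → Edge d => p ⟨0, Finset.mem_Iic.2 le_rfl⟩ :=
        measurable_pi_apply _
      exact h (measurableSet_singleton f)
    have h1 : quenchedLaw ω e {X | X 0 = f}
        = ((Kernel.traj (X := fun _ => Edge d) K 0 fun _ => e).map
          (Preorder.frestrictLe (π := fun _ => Edge d) 0))
            {p | p ⟨0, Finset.mem_Iic.2 le_rfl⟩ = f} := by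
      rw [Measure.map_apply (Preorder.measurable_frestrictLe 0) hs]
      rfl
    rw [h1, h0, Measure.dirac_apply' _ hs]
    simp [stepSum, Set.indicator]
  | succ n ih =>
    rw [quenchedLaw_succ, stepSum]
    have hX : Measurable fun X : ℕ → Edge d => X n := measurable_pi_apply n
    rw [← lintegral_map (f := fun g => transition ω g f) (measurable_of_countable _) hX,
      lintegral_countable']
    refine tsum_congr fun g => ?_
    rw [← ih, Measure.map_apply hX (measurableSet_singleton g), mul_comm]
    rfl

lemma measurableSet_visit (n : ℕ) (f : Edge d) : MeasurableSet {X : ℕ → Edge d | X n = f} := by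
  have h : Measurable fun X : ℕ → Edge d => X n := measurable_pi_apply n
  exact h (measurableSet_singleton f)

theorem green_eq_greenSum (ω : Environment d) (e f : Edge d) :
    green ω e f = greenSum (transition ω) e f := by
  have h : ∀ n, (fun X : ℕ → Edge d => if X n = f then (1 : ℝ≥0∞) else 0)
      = {X : ℕ → Edge d | X n = f}.indicator 1 := fun n => by
    funext X
    simp [Set.indicator]
  rw [green, greenSum_eq_tsum_stepSum, lintegral_tsum]
  · refine tsum_congr fun n => ?_
    rw [h, lintegral_indicator_one (measurableSet_visit n f), quenchedLaw_eq_stepSum]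
  · intro n
    rw [h]
    exact (measurable_one.indicator (measurableSet_visit n f)).aemeasurable

/-- A finite Green function on the diagonal forces transience. -/
theorem isTransient_of_green_lt_top {ω : Environment d} (e : Edge d)
    (h : ∀ f, green ω f f < ∞) : IsTransient ω e := by
  rw [IsTransient, ae_all_iff]
  intro f
  have hf : green ω e f < ∞ := by
    refine lt_of_le_of_lt ?_ (h f)
    rw [green_eq_greenSum, green_eq_greenSum]
    exact greenSum_le_diag (fun e => (tsum_transition ω e).le) e f
  rw [green] at hf
  have hm : Measurable fun X : ℕ → Edge d => ∑' n, if X n = f then (1 : ℝ≥0∞) else 0 :=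
    Measurable.tsum fun n => Measurable.ite (measurableSet_visit n f) measurable_const
      measurable_const
  filter_upwards [ae_lt_top hm hf.ne] with X hX
  refine (ENNReal.finite_const_le_of_tsum_ne_top hX.ne one_ne_zero).subset fun n hn => ?_
  simp only [Set.mem_ofPred_eq] at hn ⊢
  rw [if_pos hn]

lemma one_le_green (ω : Environment d) (e : Edge d) : 1 ≤ green ω e e := by
  rw [green_eq_greenSum, greenSum_eq_tsum_stepSum]
  refine le_trans ?_ (ENNReal.le_tsum 0)
  simp [stepSum]

lemma measurable_transition (e f : Edge d) :
    Measurable fun ω : Environment d => transition ω e f := by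
  unfold transition
  split_ifs
  · exact ENNReal.measurable_ofReal.comp ((measurable_pi_apply _).comp
      (measurable_subtype_coe.comp (measurable_pi_apply e)))
  · exact measurable_const

lemma measurable_pathWeight {V Ω : Type*} [MeasurableSpace Ω] {M : Ω → V → V → ℝ≥0∞}
    (hM : ∀ e f, Measurable fun ω => M ω e f) (e : V) (l : List V) :
    Measurable fun ω => pathWeight (M ω) e l := by
  induction l with
  | nil => simp only [pathWeight_nil]; exact measurable_const
  | cons f l ih => simp only [pathWeight_cons]; exact (hM _ _).mul ih

lemma measurable_greenSum {V Ω : Type*} [MeasurableSpace Ω] [Countable V] [DecidableEq V]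
    {M : Ω → V → V → ℝ≥0∞} (hM : ∀ e f, Measurable fun ω => M ω e f) (e f : V) :
    Measurable fun ω => greenSum (M ω) e f := by
  refine Measurable.tsum fun l => ?_
  split_ifs
  · exact measurable_pathWeight hM e l
  · exact measurable_const

lemma measurable_green (e f : Edge d) : Measurable fun ω : Environment d => green ω e f := by
  simp only [green_eq_greenSum]
  exact measurable_greenSum measurable_transition e f

end Quenched

/-! ### Moments of the hypergeometric laws -/

section Moments

variable {ι κ : Type*} [Fintype ι] [Fintype κ] [DecidableEq ι]

/-- The probability law on the simplex with density proportional to `φ(a, b; Z)`. -/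
noncomputable def hyperLaw (i₀ : ι) (a : ι → ℝ) (b : κ → ℝ) (Z : Matrix κ ι ℝ) :
    Measure (OpenSimplex ι) :=
  (hyperInt i₀ a b Z)⁻¹ • (simplexVolume i₀).withDensity fun u => ENNReal.ofReal (phi a b Z u)

lemma isProbabilityMeasure_hyperLaw (i₀ : ι) {a : ι → ℝ} {b : κ → ℝ} {Z : Matrix κ ι ℝ}
    (ha : ∀ i, 0 < a i) (hb : ∀ j, 0 < b j) (hZ : ∀ j i, 0 < Z j i) :
    IsProbabilityMeasure (hyperLaw i₀ a b Z) := by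
  refine ⟨?_⟩
  rw [hyperLaw, Measure.smul_apply, withDensity_apply _ MeasurableSet.univ, Measure.restrict_univ,
    smul_eq_mul]
  exact ENNReal.inv_mul_cancel (hyperInt_ne_zero i₀ hZ) (hyperInt_ne_top i₀ ha hb hZ)

lemma siteLaw_eq_hyperLaw (i₀ : ι) {α : ι → ℝ} {Z : Matrix ι ι ℝ}
    (hα : ∀ i, 0 < α i) (hZ : ∀ i j, 0 < Z i j) : siteLaw i₀ α Z = hyperLaw i₀ α α Z := by
  have hPhi := ofReal_Phi i₀ hα hα hZ
  have hpos : 0 < Phi i₀ α α Z := by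
    rw [← ENNReal.ofReal_pos, hPhi]
    exact pos_iff_ne_zero.2 (hyperInt_ne_zero i₀ hZ)
  rw [siteLaw, hyperLaw, ← withDensity_smul _ (measurable_phi α α Z).ennreal_ofReal]
  congr 1
  funext u
  rw [ENNReal.ofReal_mul (by positivity), one_div, ENNReal.ofReal_inv_of_pos hpos, hPhi]
  rfl

/-- A monomial in the coordinates of `u` and of `Z u`. -/
noncomputable def monomial (Z : Matrix κ ι ℝ) (x : ι → ℝ) (y : κ → ℝ) (u : OpenSimplex ι) : ℝ :=
  (∏ i, u.1 i ^ x i) * ∏ j, (Z *ᵥ u.1) j ^ (-y j)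

omit [DecidableEq ι] in
lemma measurable_monomial (Z : Matrix κ ι ℝ) (x : ι → ℝ) (y : κ → ℝ) :
    Measurable (monomial Z x y) := by
  have h : monomial Z x y = phi (fun i => x i + 1) y Z := by
    funext u
    simp [phi, monomial]
  rw [h]
  exact measurable_phi _ _ _

omit [DecidableEq ι] in
lemma monomial_pos {Z : Matrix κ ι ℝ} (hZ : ∀ j i, 0 < Z j i) (x : ι → ℝ) (y : κ → ℝ)
    (u : OpenSimplex ι) : 0 < monomial Z x y u :=
  mul_pos (Finset.prod_pos fun i _ => Real.rpow_pos_of_pos (u.2.1 i) _)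
    (Finset.prod_pos fun j _ => Real.rpow_pos_of_pos (mulVec_pos hZ u j) _)

omit [DecidableEq ι] in
lemma monomial_mul {Z : Matrix κ ι ℝ} (hZ : ∀ j i, 0 < Z j i) (x x' : ι → ℝ) (y y' : κ → ℝ)
    (u : OpenSimplex ι) :
    monomial Z x y u * monomial Z x' y' u
      = monomial Z (fun i => x i + x' i) (fun j => y j + y' j) u := by
  simp only [monomial]
  rw [mul_mul_mul_comm, ← Finset.prod_mul_distrib, ← Finset.prod_mul_distrib]
  congr 1
  · exact Finset.prod_congr rfl fun i _ => (Real.rpow_add (u.2.1 i) _ _).symm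
  · exact Finset.prod_congr rfl fun j _ => by
      rw [neg_add, Real.rpow_add (mulVec_pos hZ u j)]

lemma lintegral_monomial (i₀ : ι) {Z : Matrix κ ι ℝ} (hZ : ∀ j i, 0 < Z j i)
    (a x : ι → ℝ) (b y : κ → ℝ) :
    ∫⁻ u, ENNReal.ofReal (monomial Z x y u) ∂(hyperLaw i₀ a b Z)
      = (hyperInt i₀ a b Z)⁻¹ * hyperInt i₀ (fun i => a i + x i) (fun j => b j + y j) Z := by
  rw [hyperLaw, lintegral_smul_measure, smul_eq_mul, lintegral_withDensity_eq_lintegral_mul _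
    (measurable_phi a b Z).ennreal_ofReal (measurable_monomial Z x y).ennreal_ofReal]
  congr 1
  refine lintegral_congr fun u => ?_
  rw [Pi.mul_apply, ← ENNReal.ofReal_mul (phi_nonneg hZ u)]
  congr 1
  have h : ∀ (a : ι → ℝ) (b : κ → ℝ), phi a b Z u = monomial Z (fun i => a i - 1) b u :=
    fun a b => rfl
  rw [h, h, monomial_mul hZ]
  congr 1
  funext i
  ring

lemma prod_Gamma_pos {τ : Type*} [Fintype τ] {c : τ → ℝ} (hc : ∀ i, 0 < c i) :
    0 < ∏ i, Real.Gamma (c i) :=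
  Finset.prod_pos fun i _ => Real.Gamma_pos_of_pos (hc i)

/-- The ratio form of the duality, in which the two families of Gamma factors separate. -/
lemma hyperInt_ratio_duality [DecidableEq κ] (i₀ : ι) (k₀ : κ) {a a' : ι → ℝ} {b b' : κ → ℝ}
    {Z : Matrix κ ι ℝ} (ha : ∀ i, 0 < a i) (hb : ∀ j, 0 < b j) (ha' : ∀ i, 0 < a' i)
    (hb' : ∀ j, 0 < b' j) (hZ : ∀ j i, 0 < Z j i) (hab : ∑ i, a i = ∑ k, b k)
    (hab' : ∑ i, a' i = ∑ k, b' k) :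
    (hyperInt i₀ a b Z)⁻¹ * hyperInt i₀ a' b' Z
      = ENNReal.ofReal ((∏ i, Real.Gamma (a' i) / Real.Gamma (a i)) /
          ∏ k, Real.Gamma (b' k) / Real.Gamma (b k)) *
        ((hyperInt k₀ b a Zᵀ)⁻¹ * hyperInt k₀ b' a' Zᵀ) := by
  have hZt : ∀ i j, 0 < Zᵀ i j := fun i j => hZ j i
  have key : ∀ {a : ι → ℝ} {b : κ → ℝ}, (∀ i, 0 < a i) → (∀ j, 0 < b j) →
      ∑ i, a i = ∑ k, b k → hyperInt i₀ a b Z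
        = ENNReal.ofReal ((∏ i, Real.Gamma (a i)) / ∏ k, Real.Gamma (b k)) *
          hyperInt k₀ b a Zᵀ := by
    intro a b ha hb hab
    have h := hyperInt_duality i₀ k₀ ha hb hZ hab
    have hne : ENNReal.ofReal (∏ k, Real.Gamma (b k)) ≠ 0 := by
      simpa using prod_Gamma_pos hb
    rw [ENNReal.ofReal_div_of_pos (prod_Gamma_pos hb), ENNReal.div_eq_inv_mul, mul_assoc, ← h,
      ← mul_assoc,
      ENNReal.inv_mul_cancel hne ENNReal.ofReal_ne_top, one_mul]
  rw [key ha hb hab, key ha' hb' hab', ENNReal.mul_inv (Or.inr (hyperInt_ne_top _ hb ha hZt))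
    (Or.inl ENNReal.ofReal_ne_top), mul_mul_mul_comm,
    ← ENNReal.ofReal_inv_of_pos (div_pos (prod_Gamma_pos ha) (prod_Gamma_pos hb)),
    ← ENNReal.ofReal_mul
      (inv_nonneg.2 (div_pos (prod_Gamma_pos ha) (prod_Gamma_pos hb)).le)]
  congr 2
  rw [Finset.prod_div_distrib, Finset.prod_div_distrib, inv_div]
  have h1 := (prod_Gamma_pos ha).ne'
  have h2 := (prod_Gamma_pos ha').ne'
  have h3 := (prod_Gamma_pos hb).ne'
  have h4 := (prod_Gamma_pos hb').ne'
  field_simp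

end Moments

section BetaMoments

lemma measurable_betaPDF (a b : ℝ) : Measurable (betaPDF a b) :=
  (measurable_betaPDFReal a b).ennreal_ofReal

lemma lintegral_beta {a b : ℝ} (ha : 0 < a) (hb : 0 < b) :
    ∫⁻ x in Set.Ioo (0 : ℝ) 1, ENNReal.ofReal (x ^ (a - 1) * (1 - x) ^ (b - 1))
      = ENNReal.ofReal (beta a b) := by
  have h := lintegral_betaPDF_eq_one ha hb
  have hpos := beta_pos ha hb
  rw [lintegral_betaPDF] at h
  have h2 : ∀ x : ℝ, ENNReal.ofReal (1 / beta a b * x ^ (a - 1) * (1 - x) ^ (b - 1))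
      = ENNReal.ofReal (1 / beta a b) * ENNReal.ofReal (x ^ (a - 1) * (1 - x) ^ (b - 1)) :=
    fun x => by rw [← ENNReal.ofReal_mul (by positivity), mul_assoc]
  simp only [h2] at h
  rw [lintegral_const_mul _ (by fun_prop), one_div, ENNReal.ofReal_inv_of_pos hpos] at h
  have hne : ENNReal.ofReal (beta a b) ≠ 0 := by simpa using hpos
  calc _ = ENNReal.ofReal (beta a b) * ((ENNReal.ofReal (beta a b))⁻¹ *
        ∫⁻ x in Set.Ioo (0 : ℝ) 1, ENNReal.ofReal (x ^ (a - 1) * (1 - x) ^ (b - 1))) := by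
        rw [← mul_assoc, ENNReal.mul_inv_cancel hne ENNReal.ofReal_ne_top, one_mul]
    _ = _ := by rw [h, mul_one]

lemma lintegral_betaMeasure {a b c e : ℝ} (ha : 0 < a) (hb : 0 < b) (hac : 0 < a + c)
    (hbe : 0 < b + e) :
    ∫⁻ x, ENNReal.ofReal (x ^ c * (1 - x) ^ e) ∂(betaMeasure a b)
      = ENNReal.ofReal (beta (a + c) (b + e) / beta a b) := by
  have hpos := beta_pos ha hb
  rw [betaMeasure, lintegral_withDensity_eq_lintegral_mul _
    (measurable_betaPDF a b) (by fun_prop), div_eq_inv_mul,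
    ENNReal.ofReal_mul (inv_nonneg.2 hpos.le), ← lintegral_beta hac hbe,
    ← lintegral_const_mul _ (by fun_prop), ← lintegral_indicator measurableSet_Ioo]
  refine lintegral_congr fun x => ?_
  by_cases hx : x ∈ Set.Ioo (0 : ℝ) 1
  · rw [Set.indicator_of_mem hx, Pi.mul_apply, betaPDF_of_pos_lt_one hx.1 hx.2,
      ← ENNReal.ofReal_mul, ← ENNReal.ofReal_mul (inv_nonneg.2 hpos.le)]
    · congr 1
      have h1 : (0 : ℝ) < 1 - x := by linarith [hx.2]
      rw [show a + c - 1 = (a - 1) + c by ring, show b + e - 1 = (b - 1) + e by ring,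
        Real.rpow_add hx.1, Real.rpow_add h1]
      ring
    · have h1 : (0 : ℝ) < 1 - x := by linarith [hx.2]
      have h2 : (0 : ℝ) < x := hx.1
      positivity
  · rw [Set.indicator_of_notMem hx, Pi.mul_apply]
    have : betaPDF a b x = 0 := by
      rcases le_or_gt x 0 with h | h
      · exact betaPDF_eq_zero_of_nonpos h
      · exact betaPDF_eq_zero_of_one_le (not_lt.1 fun h1 => hx ⟨h, h1⟩)
    rw [this, zero_mul]

lemma ae_betaMeasure_mem_Ioo (a b : ℝ) : ∀ᵐ x ∂(betaMeasure a b), x ∈ Set.Ioo (0 : ℝ) 1 := by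
  rw [betaMeasure, ae_withDensity_iff (measurable_betaPDF a b)]
  refine Filter.Eventually.of_forall fun x hx => ⟨?_, ?_⟩
  · by_contra h
    exact hx (betaPDF_eq_zero_of_nonpos (not_lt.1 h))
  · by_contra h
    exact hx (betaPDF_eq_zero_of_one_le (not_lt.1 h))

end BetaMoments

/-! ### Time reversal of the killed walk -/

section Product

lemma lintegral_prod_infinitePi {X Y : Type*} [MeasurableSpace Y] (μ : X → Measure Y)
    [∀ x, IsProbabilityMeasure (μ x)] (B : Finset X) (f : X → Y → ℝ≥0∞)
    (hf : ∀ x, Measurable (f x)) :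
    ∫⁻ u, ∏ x ∈ B, f x (u x) ∂(Measure.infinitePi μ) = ∏ x ∈ B, ∫⁻ y, f x y ∂(μ x) := by
  refine (lintegral_prod_eq_prod_lintegral_of_indepFun B (fun x (u : X → Y) => f x (u x))
    (iIndepFun_infinitePi hf) fun x => (hf x).comp (measurable_pi_apply x)).trans ?_
  refine Finset.prod_congr rfl fun x _ => ?_
  conv_rhs => rw [← Measure.infinitePi_map_eval μ x]
  rw [lintegral_map (hf x) (measurable_pi_apply x)]

variable {X ι κ : Type*} [Fintype ι] [Fintype κ] [DecidableEq ι] [DecidableEq κ] [DecidableEq X]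
  [BEq (X × ι)] [LawfulBEq (X × ι)] [BEq (X × κ)] [LawfulBEq (X × κ)]

/-- A product of transition probabilities `Z i j * u j / (Z u) i`, over a list of triples
`(x, i, j)`, is a product over the sites `x` of monomials. -/
lemma prod_triples_eq_prod_monomial {Z : Matrix κ ι ℝ} (hZ : ∀ j i, 0 < Z j i) (B : Finset X)
    (u : X → OpenSimplex ι) (T : List (X × κ × ι)) (hT : ∀ t ∈ T, t.1 ∈ B) :
    (T.map fun t => ENNReal.ofReal
        (Z t.2.1 t.2.2 * (u t.1).1 t.2.2 / (Z *ᵥ (u t.1).1) t.2.1)).prod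
      = (T.map fun t => ENNReal.ofReal (Z t.2.1 t.2.2)).prod *
        ∏ x ∈ B, ENNReal.ofReal (monomial Z
          (fun j => ((T.map fun t => (t.1, t.2.2)).count (x, j) : ℝ))
          (fun i => ((T.map fun t => (t.1, t.2.1)).count (x, i) : ℝ)) (u x)) := by
  induction T with
  | nil => simp [monomial]
  | cons t T ih =>
    have hT' : ∀ t ∈ T, t.1 ∈ B := fun s hs => hT s (List.mem_cons_of_mem _ hs)
    have ht : t.1 ∈ B := hT t List.mem_cons_self
    have hmono : ∀ x, monomial Z
          (fun j => (((t :: T).map fun t => (t.1, t.2.2)).count (x, j) : ℝ))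
          (fun i => (((t :: T).map fun t => (t.1, t.2.1)).count (x, i) : ℝ)) (u x)
        = monomial Z
          (fun j => ((T.map fun t => (t.1, t.2.2)).count (x, j) : ℝ))
          (fun i => ((T.map fun t => (t.1, t.2.1)).count (x, i) : ℝ)) (u x) *
          monomial Z (fun j => if (t.1, t.2.2) = (x, j) then 1 else 0)
          (fun i => if (t.1, t.2.1) = (x, i) then 1 else 0) (u x) := fun x => by
      rw [monomial_mul hZ]
      congr 1
      · funext j
        by_cases h : (t.1, t.2.2) = (x, j) <;> simp [h]
      · funext j
        by_cases h : (t.1, t.2.1) = (x, j) <;> simp [h]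
    have hsingle : ∏ x ∈ B, ENNReal.ofReal (monomial Z
          (fun j => if (t.1, t.2.2) = (x, j) then 1 else 0)
          (fun i => if (t.1, t.2.1) = (x, i) then 1 else 0) (u x))
        = ENNReal.ofReal ((u t.1).1 t.2.2 / (Z *ᵥ (u t.1).1) t.2.1) := by
      rw [Finset.prod_eq_single t.1]
      · congr 1
        rw [monomial, Finset.prod_eq_single t.2.2, Finset.prod_eq_single t.2.1]
        · simp [Real.rpow_neg_one, div_eq_mul_inv]
        · intro i _ hi
          simp [Ne.symm hi]
        · simp
        · intro i _ hi
          simp [Ne.symm hi]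
        · simp
      · intro x _ hx
        simp [monomial, Prod.ext_iff, Ne.symm hx]
      · exact fun h => absurd ht h
    rw [List.map_cons, List.map_cons, List.prod_cons, List.prod_cons, ih hT']
    have h3 : ∀ x, ENNReal.ofReal (monomial Z
          (fun j => (((t :: T).map fun t => (t.1, t.2.2)).count (x, j) : ℝ))
          (fun i => (((t :: T).map fun t => (t.1, t.2.1)).count (x, i) : ℝ)) (u x))
        = _ := fun x => by rw [hmono, ENNReal.ofReal_mul (monomial_pos hZ _ _ _).le]
    rw [Finset.prod_congr rfl fun x _ => h3 x, Finset.prod_mul_distrib, hsingle, mul_div_assoc,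
      ENNReal.ofReal_mul (hZ _ _).le]
    ring

end Product

section Reversal

variable {d : ℕ}

/-- An edge is determined by its head and its direction. -/
def headDir : Edge d ≃ (Fin d → ℤ) × Dir d where
  toFun e := (head e, e.2)
  invFun p := (p.1 - dirVec p.2, p.2)
  left_inv e := by simp [head]
  right_inv p := by simp [head]

/-- The transition weights of the walk killed outside the vertex set `B`, in the environment built
from `u`. -/
noncomputable def killed (Z : Matrix (Dir d) (Dir d) ℝ) (B : Finset (Fin d → ℤ))
    (u : (Fin d → ℤ) → OpenSimplex (Dir d)) (e f : Edge d) : ℝ≥0∞ :=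
  if f.1 = head e ∧ f.1 ∈ B then
    ENNReal.ofReal (Z e.2 f.2 * (u f.1).1 f.2 / (Z *ᵥ (u f.1).1) e.2) else 0

/-- The transition weights of the reversed walk, from `f` to `e`, in the environment built from `v`
with the transposed matrix. -/
noncomputable def reversed (Z : Matrix (Dir d) (Dir d) ℝ) (B : Finset (Fin d → ℤ))
    (v : (Fin d → ℤ) → OpenSimplex (Dir d)) (e f : Edge d) : ℝ≥0∞ :=
  if f.1 = head e ∧ f.1 ∈ B then
    ENNReal.ofReal (Zᵀ f.2 e.2 * (v f.1).1 e.2 / (Zᵀ *ᵥ (v f.1).1) f.2) else 0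

/-- A list of arcs of the arc graph all of whose middle vertices lie in `B`. -/
def Admissible (B : Finset (Fin d → ℤ)) (A : List (Edge d × Edge d)) : Prop :=
  ∀ p ∈ A, p.2.1 = head p.1 ∧ p.2.1 ∈ B

/-- The number of arcs of `A` leading to the edge `f`. -/
def inCount (A : List (Edge d × Edge d)) (f : Edge d) : ℕ := (A.map Prod.snd).count f

/-- The number of arcs of `A` starting from the edge `e`. -/
def outCount (A : List (Edge d × Edge d)) (e : Edge d) : ℕ := (A.map Prod.fst).count e

lemma count_headDir {B : Finset (Fin d → ℤ)} {A : List (Edge d × Edge d)} (hA : Admissible B A)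
    (x : Fin d → ℤ) (i : Dir d) :
    (A.map fun p => (p.2.1, p.1.2)).count (x, i) = outCount A (headDir.symm (x, i)) := by
  have h1 : (A.map fun p => (p.2.1, p.1.2)) = (A.map Prod.fst).map headDir := by
    rw [List.map_map]
    refine List.map_congr_left fun p hp => ?_
    rw [(hA p hp).1]
    rfl
  rw [h1, outCount]
  conv_rhs => rw [← List.count_map_of_injective _ headDir headDir.injective]
  rw [Equiv.apply_symm_apply]

/-- The weight of an admissible family of arcs is a product of monomials at the vertices, whose
exponents count the passages through the edges leaving and entering each vertex. -/
lemma prod_killed {Z : Matrix (Dir d) (Dir d) ℝ} (hZ : ∀ i j, 0 < Z i j)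
    {B : Finset (Fin d → ℤ)} (u : (Fin d → ℤ) → OpenSimplex (Dir d))
    {A : List (Edge d × Edge d)} (hA : Admissible B A) :
    (A.map fun p => killed Z B u p.1 p.2).prod
      = (A.map fun p => ENNReal.ofReal (Z p.1.2 p.2.2)).prod *
        ∏ x ∈ B, ENNReal.ofReal (monomial Z (fun j => (inCount A (x, j) : ℝ))
          (fun i => (outCount A (headDir.symm (x, i)) : ℝ)) (u x)) := by
  have h := prod_triples_eq_prod_monomial hZ B u (A.map fun p => (p.2.1, p.1.2, p.2.2)) (by
    intro t ht
    obtain ⟨p, hp, rfl⟩ := List.mem_map.1 ht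
    exact (hA p hp).2)
  simp only [List.map_map, Function.comp_def] at h
  rw [List.map_congr_left fun p hp => by rw [killed, if_pos (hA p hp)], h]
  congr 1
  refine Finset.prod_congr rfl fun x _ => ?_
  simp only [count_headDir hA]
  rfl

/-- The reversed weights carry the same constant as `killed`, and monomials in which the edges
leaving and entering each vertex are exchanged. -/
lemma prod_reversed {Z : Matrix (Dir d) (Dir d) ℝ} (hZ : ∀ i j, 0 < Z i j)
    {B : Finset (Fin d → ℤ)} (v : (Fin d → ℤ) → OpenSimplex (Dir d))
    {A : List (Edge d × Edge d)} (hA : Admissible B A) :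
    (A.map fun p => reversed Z B v p.1 p.2).prod
      = (A.map fun p => ENNReal.ofReal (Z p.1.2 p.2.2)).prod *
        ∏ x ∈ B, ENNReal.ofReal (monomial Zᵀ (fun i => (outCount A (headDir.symm (x, i)) : ℝ))
          (fun j => (inCount A (x, j) : ℝ)) (v x)) := by
  have h := prod_triples_eq_prod_monomial (Z := Zᵀ) (fun i j => hZ j i) B v
    (A.map fun p => (p.2.1, p.2.2, p.1.2)) (by
      intro t ht
      obtain ⟨p, hp, rfl⟩ := List.mem_map.1 ht
      exact (hA p hp).2)
  simp only [List.map_map, Function.comp_def] at h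
  rw [List.map_congr_left fun p hp => by rw [reversed, if_pos (hA p hp)], h]
  congr 1
  refine Finset.prod_congr rfl fun x _ => ?_
  simp only [count_headDir hA]
  rfl

lemma prod_eq_zero_of_not_admissible {B : Finset (Fin d → ℤ)} {A : List (Edge d × Edge d)}
    (hA : ¬ Admissible B A) {M : Edge d → Edge d → ℝ≥0∞}
    (hM : ∀ e f, ¬ (f.1 = head e ∧ f.1 ∈ B) → M e f = 0) :
    (A.map fun p => M p.1 p.2).prod = 0 := by
  simp only [Admissible, not_forall] at hA
  obtain ⟨p, hp, h⟩ := hA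
  exact List.prod_eq_zero (List.mem_map.2 ⟨p, hp, hM _ _ h⟩)

/-- Each arc through the vertex `x` enters `x` once and leaves it once. -/
lemma sum_inCount_eq {B : Finset (Fin d → ℤ)} {A : List (Edge d × Edge d)} (hA : Admissible B A)
    (x : Fin d → ℤ) : ∑ j, inCount A (x, j) = ∑ i, outCount A (headDir.symm (x, i)) := by
  have hcount : ∀ g : Edge d × Edge d → Dir d, ∑ j, (A.map fun p => (p.2.1, g p)).count (x, j)
      = A.countP fun p => p.2.1 = x := by
    intro g
    clear hA
    induction A with
    | nil => simp
    | cons p A ih =>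
      simp only [List.map_cons, List.count_cons, List.countP_cons, Finset.sum_add_distrib, ih]
      congr 1
      by_cases h : p.2.1 = x <;> simp [h]
  simp only [← count_headDir hA]
  rw [hcount, ← hcount fun p => p.2.2]
  rfl

/-- The reversed walk, which goes from the second argument to the first, is substochastic. -/
lemma tsum_reversed_le {Z : Matrix (Dir d) (Dir d) ℝ} (hZ : ∀ i j, 0 < Z i j)
    (B : Finset (Fin d → ℤ)) (v : (Fin d → ℤ) → OpenSimplex (Dir d)) (f : Edge d) :
    ∑' e, reversed Z B v e f ≤ 1 := by
  rw [← headDir.symm.tsum_eq, ENNReal.tsum_prod', tsum_eq_single f.1]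
  · rw [tsum_fintype]
    have hpos : 0 < (Zᵀ *ᵥ (v f.1).1) f.2 := mulVec_pos (fun i j => hZ j i) _ _
    have hle : ∀ i, reversed Z B v (headDir.symm (f.1, i)) f
        ≤ ENNReal.ofReal (Zᵀ f.2 i * (v f.1).1 i / (Zᵀ *ᵥ (v f.1).1) f.2) := by
      intro i
      unfold reversed
      split_ifs
      · exact le_rfl
      · exact zero_le
    refine (Finset.sum_le_sum fun i _ => hle i).trans ?_
    rw [← ENNReal.ofReal_sum_of_nonneg (f := fun i => Zᵀ f.2 i * (v f.1).1 i /
      (Zᵀ *ᵥ (v f.1).1) f.2) fun i _ =>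
      div_nonneg (mul_nonneg (hZ i f.2).le ((v f.1).2.1 i).le) hpos.le, ← Finset.sum_div]
    have : ∑ i, Zᵀ f.2 i * (v f.1).1 i = (Zᵀ *ᵥ (v f.1).1) f.2 := rfl
    rw [this, div_self hpos.ne', ENNReal.ofReal_one]
  · intro x hx
    rw [ENNReal.tsum_eq_zero]
    intro i
    have : head (headDir.symm (x, i)) = x := by simp [head, headDir]
    rw [reversed, if_neg (by rw [this]; exact fun h => hx h.1.symm)]

/-- The Gamma factors of the two ends of each edge cancel, except for the edge `e₀` whose parameters
at its tail and at its head differ. -/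
lemma prod_gamma_telescope {B : Finset (Fin d → ℤ)} {G₁ G₂ : Edge d → ℝ} (e₀ : Edge d)
    (h1 : ∀ f, f.1 ∉ B → G₁ f = 1) (h2 : ∀ f, head f ∉ B → G₂ f = 1)
    (h12 : ∀ f, f ≠ e₀ → G₁ f = G₂ f) (hpos : ∀ f, G₂ f ≠ 0) :
    ∏ x ∈ B, ((∏ j, G₁ (x, j)) / ∏ i, G₂ (headDir.symm (x, i))) = G₁ e₀ / G₂ e₀ := by
  classical
  rw [Finset.prod_div_distrib, ← Finset.prod_product', ← Finset.prod_product']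
  set S₁ : Finset (Edge d) := B ×ˢ Finset.univ
  set S₂ : Finset (Edge d) := (B ×ˢ Finset.univ).map headDir.symm.toEmbedding
  have hS₂ : ∏ p ∈ B ×ˢ (Finset.univ : Finset (Dir d)), G₂ (headDir.symm (p.1, p.2))
      = ∏ f ∈ S₂, G₂ f := by
    rw [Finset.prod_map]
    rfl
  have hm1 : ∀ f, f ∉ S₁ → f.1 ∉ B := fun f hf h => hf (by simp [S₁, h])
  have hm2 : ∀ f, f ∉ S₂ → head f ∉ B := fun f hf h => hf (by
    rw [Finset.mem_map_equiv]
    simp [headDir, h])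
  rw [hS₂, Finset.prod_subset (Finset.subset_union_left (s₂ := S₂)) fun f _ hf => h1 f (hm1 f hf),
    Finset.prod_subset (Finset.subset_union_right (s₁ := S₁)) fun f _ hf => h2 f (hm2 f hf),
    ← Finset.prod_div_distrib]
  refine Finset.prod_eq_single e₀ (fun f _ hf => ?_) fun hf => ?_
  · rw [h12 f hf, div_self (hpos f)]
  · simp only [Finset.mem_union, not_or] at hf
    rw [h1 _ (hm1 _ hf.1), h2 _ (hm2 _ hf.2), div_one]

end Reversal

section ReversalBound

variable {d : ℕ} [NeZero d]

/-- The law of the field of the reversed walk. -/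
noncomputable def reversedLaw (a b : Edge d → ℝ) (Z : Matrix (Dir d) (Dir d) ℝ) :
    Measure ((Fin d → ℤ) → OpenSimplex (Dir d)) :=
  Measure.infinitePi fun x =>
    hyperLaw (0, true) (fun i => b (headDir.symm (x, i))) (fun j => a (x, j)) Zᵀ

variable {α : Dir d → ℝ} {Z : Matrix (Dir d) (Dir d) ℝ}

lemma isProbabilityMeasure_reversedLaw {a b : Edge d → ℝ} (ha : ∀ e, 0 < a e) (hb : ∀ e, 0 < b e)
    (hZ : ∀ i j, 0 < Z i j) : IsProbabilityMeasure (reversedLaw a b Z) := by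
  have : ∀ x : Fin d → ℤ, IsProbabilityMeasure (hyperLaw ((0, true) : Dir d)
      (fun i => b (headDir.symm (x, i))) (fun j => a (x, j)) Zᵀ) := fun x =>
    isProbabilityMeasure_hyperLaw _ (fun _ => hb _) (fun _ => ha _) fun i j => hZ j i
  unfold reversedLaw
  infer_instance

lemma vertexLaw_eq (hα : ∀ i, 0 < α i) (hZ : ∀ i j, 0 < Z i j) :
    vertexLaw α Z = Measure.infinitePi fun _ : Fin d → ℤ => hyperLaw (0, true) α α Z := by
  rw [vertexLaw]
  congr 1
  funext x
  exact siteLaw_eq_hyperLaw _ hα hZ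

/-- The density, up to a constant, of the law with parameters `a`, `b` at the vertex `x` with
respect to the law with parameters `α`. -/
noncomputable def tilt (α : Dir d → ℝ) (a b : Edge d → ℝ) (Z : Matrix (Dir d) (Dir d) ℝ)
    (x : Fin d → ℤ) : OpenSimplex (Dir d) → ℝ :=
  monomial Z (fun j => a (x, j) - α j) (fun i => b (headDir.symm (x, i)) - α i)

/-- The expectation of `tilt α a b Z x` under the law with parameters `α`. -/
noncomputable def tiltMass (α : Dir d → ℝ) (a b : Edge d → ℝ) (Z : Matrix (Dir d) (Dir d) ℝ)
    (x : Fin d → ℤ) : ℝ≥0∞ :=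
  (hyperInt (0, true) α α Z)⁻¹ *
    hyperInt (0, true) (fun j => a (x, j)) (fun i => b (headDir.symm (x, i))) Z

lemma lintegral_tilt (hZ : ∀ i j, 0 < Z i j) (a b : Edge d → ℝ) (x : Fin d → ℤ) :
    ∫⁻ u, ENNReal.ofReal (tilt α a b Z x u) ∂(hyperLaw (0, true) α α Z) = tiltMass α a b Z x := by
  unfold tilt tiltMass
  rw [lintegral_monomial _ hZ]
  simp only [add_sub_cancel]

/-- The weights of the reversed walk when it survives each arc leaving `e₀` with probability `y`, in
the environment built from `v`, for a pair `(y, v)`. -/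
noncomputable def reversedKilled (Z : Matrix (Dir d) (Dir d) ℝ) (B : Finset (Fin d → ℤ))
    (e₀ : Edge d) (p : ℝ × ((Fin d → ℤ) → OpenSimplex (Dir d))) (e f : Edge d) : ℝ≥0∞ :=
  (if f = e₀ then ENNReal.ofReal p.1 else 1) * reversed Z B p.2 e f

/-- Under the tilted law, a product of transition probabilities over a closed family of arcs has the
same expectation as for the reversed walk, up to the moment of a beta variable which accounts for
the difference `h` of the parameters of `e₀` at its two ends. -/
lemma lintegral_tilt_mul_prod_killed (hα : ∀ i, 0 < α i) (hZ : ∀ i j, 0 < Z i j)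
    {a b : Edge d → ℝ} {h : ℝ} {e₀ : Edge d} (ha : ∀ e, 0 < a e) (hh : 0 < h)
    (hb₀ : b e₀ = a e₀ + h) (hb : ∀ e, e ≠ e₀ → b e = a e) {B : Finset (Fin d → ℤ)}
    (hbal : ∀ x ∈ B, ∑ j, a (x, j) = ∑ i, b (headDir.symm (x, i)))
    {A : List (Edge d × Edge d)} (hA : Admissible B A) (hclosed : ∀ f, outCount A f = inCount A f) :
    ∫⁻ u, (∏ x ∈ B, ENNReal.ofReal (tilt α a b Z x (u x))) *
        (A.map fun p => killed Z B u p.1 p.2).prod ∂(vertexLaw α Z)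
      = (∏ x ∈ B, tiltMass α a b Z x) * ∫⁻ y, ∫⁻ v,
        (A.map fun p => reversedKilled Z B e₀ (y, v) p.1 p.2).prod
          ∂(reversedLaw a b Z) ∂(betaMeasure (a e₀) h) := by
  have hbpos : ∀ e, 0 < b e := fun e => by
    by_cases he : e = e₀
    · rw [he, hb₀]; linarith [ha e₀]
    · rw [hb e he]; exact ha e
  have hprob : IsProbabilityMeasure (hyperLaw ((0, true) : Dir d) α α Z) :=
    isProbabilityMeasure_hyperLaw _ hα hα hZ
  have hZt : ∀ i j, 0 < Zᵀ i j := fun i j => hZ j i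
  have hprob' : ∀ x : Fin d → ℤ, IsProbabilityMeasure (hyperLaw ((0, true) : Dir d)
      (fun i => b (headDir.symm (x, i))) (fun j => a (x, j)) Zᵀ) := fun x =>
    isProbabilityMeasure_hyperLaw _ (fun _ => hbpos _) (fun _ => ha _) hZt
  set C := (A.map fun p => ENNReal.ofReal (Z p.1.2 p.2.2)).prod with hC
  -- Multiplying by the weights of `A` shifts the parameters by the numbers of passages.
  let a' : Edge d → ℝ := fun f => a f + inCount A f
  let b' : Edge d → ℝ := fun f => b f + outCount A f
  have hleft : ∫⁻ u, (∏ x ∈ B, ENNReal.ofReal (tilt α a b Z x (u x))) *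
        (A.map fun p => killed Z B u p.1 p.2).prod ∂(vertexLaw α Z)
      = C * ∏ x ∈ B, tiltMass α a' b' Z x := by
    have h1 : ∀ u : (Fin d → ℤ) → OpenSimplex (Dir d),
        (∏ x ∈ B, ENNReal.ofReal (tilt α a b Z x (u x))) *
          (A.map fun p => killed Z B u p.1 p.2).prod
        = C * ∏ x ∈ B, ENNReal.ofReal (tilt α a' b' Z x (u x)) := fun u => by
      rw [prod_killed hZ u hA, mul_left_comm, ← Finset.prod_mul_distrib]
      congr 1
      refine Finset.prod_congr rfl fun x _ => ?_
      rw [tilt, ← ENNReal.ofReal_mul (monomial_pos hZ _ _ _).le, monomial_mul hZ, tilt]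
      simp only [a', b', sub_add_eq_add_sub]
    simp only [h1]
    have hm : ∀ x, Measurable fun u => ENNReal.ofReal (tilt α a' b' Z x u) := fun x =>
      (measurable_monomial _ _ _).ennreal_ofReal
    have hm2 : Measurable fun u : (Fin d → ℤ) → OpenSimplex (Dir d) =>
        ∏ x ∈ B, ENNReal.ofReal (tilt α a' b' Z x (u x)) :=
      Finset.measurable_prod _ fun x _ => (hm x).comp (measurable_pi_apply x)
    rw [lintegral_const_mul _ hm2, vertexLaw_eq hα hZ,
      lintegral_prod_infinitePi _ B (fun x u => ENNReal.ofReal (tilt α a' b' Z x u)) hm]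
    simp only [lintegral_tilt hZ]
  -- The duality applies before and after the shift, since both pairs of parameters are balanced.
  have hsite : ∀ x ∈ B, tiltMass α a' b' Z x = tiltMass α a b Z x * (ENNReal.ofReal
      ((∏ j, Real.Gamma (a' (x, j)) / Real.Gamma (a (x, j))) /
        ∏ i, Real.Gamma (b' (headDir.symm (x, i))) / Real.Gamma (b (headDir.symm (x, i)))) *
      ∫⁻ v, ENNReal.ofReal (monomial Zᵀ (fun i => (outCount A (headDir.symm (x, i)) : ℝ))
          (fun j => (inCount A (x, j) : ℝ)) v) ∂(hyperLaw ((0, true) : Dir d)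
      (fun i => b (headDir.symm (x, i))) (fun j => a (x, j)) Zᵀ)) := by
    intro x hx
    rw [lintegral_monomial _ hZt, ← hyperInt_ratio_duality _ _ (fun _ => ha _) (fun _ => hbpos _)
      (fun j => add_pos_of_pos_of_nonneg (ha _) (Nat.cast_nonneg _))
      (fun j => add_pos_of_pos_of_nonneg (hbpos _) (Nat.cast_nonneg _)) hZ (hbal x hx)]
    · unfold tiltMass
      rw [mul_assoc, ← mul_assoc (hyperInt _ _ (fun i => b (headDir.symm (x, i))) Z),
        ENNReal.mul_inv_cancel (hyperInt_ne_zero _ hZ)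
          (hyperInt_ne_top _ (fun _ => ha _) (fun _ => hbpos _) hZ), one_mul]
    · rw [Finset.sum_add_distrib, Finset.sum_add_distrib, hbal x hx]
      congr 1
      exact_mod_cast sum_inCount_eq hA x
  have hGpos : ∀ {c : ℝ} (n : ℕ), 0 < c → 0 < Real.Gamma (c + n) / Real.Gamma c := fun n hc =>
    div_pos (Real.Gamma_pos_of_pos (by positivity)) (Real.Gamma_pos_of_pos hc)
  have hzero : ∀ f : Edge d, f.1 ∉ B → inCount A f = 0 := fun f hf => by
    rw [inCount, List.count_eq_zero]
    intro h
    obtain ⟨p, hp, rfl⟩ := List.mem_map.1 h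
    exact hf (hA p hp).2
  have hzero' : ∀ f : Edge d, head f ∉ B → outCount A f = 0 := fun f hf => by
    rw [outCount, List.count_eq_zero]
    intro h
    obtain ⟨p, hp, rfl⟩ := List.mem_map.1 h
    exact hf ((hA p hp).1 ▸ (hA p hp).2)
  have hone : ∀ {c : ℝ}, 0 < c → Real.Gamma (c + (0 : ℕ)) / Real.Gamma c = 1 := fun hc => by
    rw [Nat.cast_zero, add_zero, div_self (Real.Gamma_pos_of_pos hc).ne']
  set n := inCount A e₀ with hn
  -- What remains of the Gamma factors is `Γ(a + n) Γ(a + h) / (Γ(a) Γ(a + h + n))` with `a = a e₀`.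
  have hgamma : ∏ x ∈ B, ENNReal.ofReal
      ((∏ j, Real.Gamma (a' (x, j)) / Real.Gamma (a (x, j))) /
        ∏ i, Real.Gamma (b' (headDir.symm (x, i))) / Real.Gamma (b (headDir.symm (x, i))))
      = ∫⁻ y, ENNReal.ofReal y ^ n ∂(betaMeasure (a e₀) h) := by
    rw [← ENNReal.ofReal_prod_of_nonneg fun x _ => div_nonneg
      (Finset.prod_nonneg fun j _ => (hGpos _ (ha _)).le)
      (Finset.prod_nonneg fun j _ => (hGpos _ (hbpos _)).le),
      prod_gamma_telescope (G₁ := fun f => Real.Gamma (a' f) / Real.Gamma (a f))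
        (G₂ := fun f => Real.Gamma (b' f) / Real.Gamma (b f)) e₀
        (fun f hf => by simp only [a', hzero f hf]; exact hone (ha f))
        (fun f hf => by simp only [b', hzero' f hf]; exact hone (hbpos f))
        (fun f hf => by simp only [a', b', hclosed, hb f hf])
        (fun f => (hGpos _ (hbpos f)).ne')]
    have h1 := lintegral_betaMeasure (c := n) (e := 0) (ha e₀) hh
      (add_pos_of_pos_of_nonneg (ha e₀) (Nat.cast_nonneg _)) (by simpa using hh)
    have h2 : ∀ᵐ y ∂(betaMeasure (a e₀) h),
        ENNReal.ofReal y ^ n = ENNReal.ofReal (y ^ (n : ℝ) * (1 - y) ^ (0 : ℝ)) := by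
      filter_upwards [ae_betaMeasure_mem_Ioo (a e₀) h] with y hy
      rw [Real.rpow_zero, mul_one, Real.rpow_natCast, ENNReal.ofReal_pow hy.1.le]
    rw [lintegral_congr_ae h2, h1]
    congr 1
    simp only [a', b', hclosed, ← hn, beta, hb₀, add_zero]
    have g1 := (Real.Gamma_pos_of_pos (ha e₀)).ne'
    have g2 := (Real.Gamma_pos_of_pos hh).ne'
    have g3 := (Real.Gamma_pos_of_pos (add_pos (ha e₀) hh)).ne'
    have g4 := (Real.Gamma_pos_of_pos (show 0 < a e₀ + h + n by have := ha e₀; positivity)).ne'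
    rw [show a e₀ + n + h = a e₀ + h + n by ring]
    field_simp
  have hmv : ∀ x : Fin d → ℤ, Measurable fun v : OpenSimplex (Dir d) => ENNReal.ofReal
      (monomial Zᵀ (fun i => (outCount A (headDir.symm (x, i)) : ℝ))
          (fun j => (inCount A (x, j) : ℝ)) v) :=
    fun x => (measurable_monomial _ _ _).ennreal_ofReal
  have hright : ∀ y : ℝ, ∫⁻ v, (A.map fun p => reversedKilled Z B e₀ (y, v) p.1 p.2).prod
        ∂(reversedLaw a b Z)
      = (C * ∏ x ∈ B, ∫⁻ v, ENNReal.ofReal (monomial Zᵀ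
          (fun i => (outCount A (headDir.symm (x, i)) : ℝ))
          (fun j => (inCount A (x, j) : ℝ)) v) ∂(hyperLaw ((0, true) : Dir d)
          (fun i => b (headDir.symm (x, i))) (fun j => a (x, j)) Zᵀ)) * ENNReal.ofReal y ^ n := by
    intro y
    have hy : (A.map fun p => if p.2 = e₀ then ENNReal.ofReal y else 1).prod
        = ENNReal.ofReal y ^ n := by
      rw [hn, inCount]
      clear * -
      induction A with
      | nil => simp
      | cons p A ih =>
        by_cases h : p.2 = e₀
        · simp [h, ih, pow_succ, mul_comm]
        · simp [h, ih]
    simp only [reversedKilled, List.prod_map_mul, hy, prod_reversed hZ _ hA, ← hC]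
    have hm2 : Measurable fun v : (Fin d → ℤ) → OpenSimplex (Dir d) =>
        ∏ x ∈ B, ENNReal.ofReal (monomial Zᵀ
          (fun i => (outCount A (headDir.symm (x, i)) : ℝ))
          (fun j => (inCount A (x, j) : ℝ)) (v x)) :=
      Finset.measurable_prod _ fun x _ => (hmv x).comp (measurable_pi_apply x)
    rw [lintegral_const_mul _ (hm2.const_mul C), lintegral_const_mul _ hm2, reversedLaw,
      lintegral_prod_infinitePi _ B (fun x v => ENNReal.ofReal (monomial Zᵀ
          (fun i => (outCount A (headDir.symm (x, i)) : ℝ))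
          (fun j => (inCount A (x, j) : ℝ)) v)) hmv, mul_comm]
  rw [hleft, Finset.prod_congr rfl hsite, Finset.prod_mul_distrib, Finset.prod_mul_distrib, hgamma]
  simp only [hright]
  rw [lintegral_const_mul _ (by fun_prop)]
  ring

omit [NeZero d] in
lemma measurable_apply_dir (x : Fin d → ℤ) (j : Dir d) :
    Measurable fun u : (Fin d → ℤ) → OpenSimplex (Dir d) => (u x).1 j :=
  (measurable_pi_apply j).comp (measurable_subtype_coe.comp (measurable_pi_apply x))

omit [NeZero d] in
lemma measurable_mulVec_apply (W : Matrix (Dir d) (Dir d) ℝ) (x : Fin d → ℤ) (i : Dir d) :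
    Measurable fun u : (Fin d → ℤ) → OpenSimplex (Dir d) => (W *ᵥ (u x).1) i := by
  simp only [Matrix.mulVec, dotProduct]
  exact Finset.measurable_sum _ fun j _ => (measurable_apply_dir x j).const_mul _

omit [NeZero d] in
lemma measurable_killed (B : Finset (Fin d → ℤ)) (e f : Edge d) :
    Measurable fun u => killed Z B u e f := by
  unfold killed
  split_ifs
  · exact (((measurable_apply_dir _ _).const_mul _).div
      (measurable_mulVec_apply _ _ _)).ennreal_ofReal
  · exact measurable_const

omit [NeZero d] in
lemma measurable_reversed (B : Finset (Fin d → ℤ)) (e f : Edge d) :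
    Measurable fun v => reversed Z B v e f := by
  unfold reversed
  split_ifs
  · exact (((measurable_apply_dir _ _).const_mul _).div
      (measurable_mulVec_apply _ _ _)).ennreal_ofReal
  · exact measurable_const

lemma measurable_list_prod {Ω V : Type*} [MeasurableSpace Ω] (A : List V) {F : Ω → V → ℝ≥0∞}
    (hF : ∀ p ∈ A, Measurable fun ω => F ω p) : Measurable fun ω => (A.map (F ω)).prod := by
  induction A with
  | nil => simp only [List.map_nil, List.prod_nil]; exact measurable_const
  | cons p A ih =>
    simp only [List.map_cons, List.prod_cons]
    exact (hF p List.mem_cons_self).mul (ih fun p hp => hF p (List.mem_cons_of_mem _ hp))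

omit [NeZero d] in
lemma measurable_reversedKilled (B : Finset (Fin d → ℤ)) (e₀ e f : Edge d) :
    Measurable fun p => reversedKilled Z B e₀ p e f := by
  refine Measurable.mul ?_ ((measurable_reversed B e f).comp measurable_snd)
  split_ifs
  · exact measurable_fst.ennreal_ofReal
  · exact measurable_const

omit [NeZero d] in
lemma greenSum_reversedKilled_pow_le (hZ : ∀ i j, 0 < Z i j) (B : Finset (Fin d → ℤ))
    (e₀ : Edge d) {y : ℝ} (hy : y ∈ Set.Ioo (0 : ℝ) 1) (v : (Fin d → ℤ) → OpenSimplex (Dir d))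
    (q : ℕ) : greenSum (reversedKilled Z B e₀ (y, v)) e₀ e₀ ^ q
      ≤ ENNReal.ofReal (y ^ (0 : ℝ) * (1 - y) ^ (-(q : ℝ))) := by
  have h1y : 0 < 1 - y := by linarith [hy.2]
  have h1 : greenSum (reversedKilled Z B e₀ (y, v)) e₀ e₀ ≤ (1 - ENNReal.ofReal y)⁻¹ := by
    refine greenSum_self_le (by rw [← ENNReal.ofReal_one]; exact
      (ENNReal.ofReal_lt_ofReal_iff one_pos).2 hy.2) fun f => ?_
    simp only [reversedKilled]
    rw [ENNReal.tsum_mul_left]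
    exact mul_le_of_le_one_right' (tsum_reversed_le hZ B v f)
  calc _ ≤ ((1 - ENNReal.ofReal y)⁻¹) ^ q := by gcongr
    _ = _ := by
      rw [← ENNReal.ofReal_one, ← ENNReal.ofReal_sub _ hy.1.le, ← ENNReal.ofReal_inv_of_pos h1y,
        ← ENNReal.ofReal_pow (inv_nonneg.2 h1y.le), Real.rpow_zero, one_mul,
        Real.rpow_neg h1y.le, Real.rpow_natCast, inv_pow]

/-- Moments of the killed Green function under the tilted law. After reversal the walk started at
`e₀` has to survive a beta distributed killing at each return to `e₀`. -/
theorem lintegral_tilt_mul_greenSum_pow_le (hα : ∀ i, 0 < α i) (hZ : ∀ i j, 0 < Z i j)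
    {a b : Edge d → ℝ} {h : ℝ} {e₀ : Edge d} (ha : ∀ e, 0 < a e) {q : ℕ} (hq : (q : ℝ) < h)
    (hb₀ : b e₀ = a e₀ + h) (hb : ∀ e, e ≠ e₀ → b e = a e) {B : Finset (Fin d → ℤ)}
    (hbal : ∀ x ∈ B, ∑ j, a (x, j) = ∑ i, b (headDir.symm (x, i))) :
    ∫⁻ u, (∏ x ∈ B, ENNReal.ofReal (tilt α a b Z x (u x))) *
        greenSum (killed Z B u) e₀ e₀ ^ q ∂(vertexLaw α Z)
      ≤ (∏ x ∈ B, tiltMass α a b Z x) *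
        ENNReal.ofReal (beta (a e₀) (h - q) / beta (a e₀) h) := by
  have hh : 0 < h := lt_of_le_of_lt (Nat.cast_nonneg q) hq
  have hbpos : ∀ e, 0 < b e := fun e => by
    by_cases he : e = e₀
    · rw [he, hb₀]; linarith [ha e₀]
    · rw [hb e he]; exact ha e
  have := isProbabilityMeasure_reversedLaw ha hbpos hZ
  have := isProbabilityMeasureBeta (ha e₀) hh
  have hmt : Measurable fun u : (Fin d → ℤ) → OpenSimplex (Dir d) =>
      ∏ x ∈ B, ENNReal.ofReal (tilt α a b Z x (u x)) :=
    Finset.measurable_prod _ fun x _ =>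
      (measurable_monomial _ _ _).ennreal_ofReal.comp (measurable_pi_apply x)
  have hmk : ∀ A : List (Edge d × Edge d),
      Measurable fun u => (A.map fun p => killed Z B u p.1 p.2).prod := fun A =>
    measurable_list_prod A fun p _ => measurable_killed B p.1 p.2
  have hmr : ∀ A : List (Edge d × Edge d),
      Measurable fun p => (A.map fun c => reversedKilled Z B e₀ p c.1 c.2).prod := fun A =>
    measurable_list_prod A fun p _ => measurable_reversedKilled B e₀ p.1 p.2
  have hterm : ∀ L : Fin q → List (Edge d),
      ∫⁻ u, (∏ x ∈ B, ENNReal.ofReal (tilt α a b Z x (u x))) *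
        (if ∀ k, (L k).headD e₀ = e₀ then
          ((multiArcs e₀ L).map fun p => killed Z B u p.1 p.2).prod else 0) ∂(vertexLaw α Z)
      = (∏ x ∈ B, tiltMass α a b Z x) * ∫⁻ y, ∫⁻ v, (if ∀ k, (L k).headD e₀ = e₀ then
          ((multiArcs e₀ L).map fun c => reversedKilled Z B e₀ (y, v) c.1 c.2).prod else 0)
        ∂(reversedLaw a b Z) ∂(betaMeasure (a e₀) h) := by
    intro L
    by_cases hL : ∀ k, (L k).headD e₀ = e₀
    · simp only [if_pos hL]
      by_cases hA : Admissible B (multiArcs e₀ L)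
      · exact lintegral_tilt_mul_prod_killed hα hZ ha hh hb₀ hb hbal hA
          fun f => count_multiArcs e₀ f L hL
      · have h1 : ∀ u, ((multiArcs e₀ L).map fun p => killed Z B u p.1 p.2).prod = 0 := fun u =>
          prod_eq_zero_of_not_admissible hA fun e f hef => if_neg hef
        have h2 : ∀ p,
            ((multiArcs e₀ L).map fun c => reversedKilled Z B e₀ p c.1 c.2).prod = 0 := fun p =>
          prod_eq_zero_of_not_admissible hA fun e f hef => by
            simp only [reversedKilled, reversed, if_neg hef, mul_zero]
        simp only [h1, h2, mul_zero, lintegral_zero]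
    · simp only [if_neg hL, mul_zero, lintegral_zero]
  have hm1 : ∀ L : Fin q → List (Edge d), Measurable fun p => if ∀ k, (L k).headD e₀ = e₀ then
      ((multiArcs e₀ L).map fun c => reversedKilled Z B e₀ p c.1 c.2).prod else 0 := fun L => by
    by_cases hL : ∀ k, (L k).headD e₀ = e₀
    · simp only [if_pos hL]; exact hmr _
    · simp only [if_neg hL]; exact measurable_const
  have hm3 : ∀ L : Fin q → List (Edge d), Measurable fun y => ∫⁻ v,
      (if ∀ k, (L k).headD e₀ = e₀ then
      ((multiArcs e₀ L).map fun c => reversedKilled Z B e₀ (y, v) c.1 c.2).prod else 0)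
      ∂(reversedLaw a b Z) := fun L => (hm1 L).lintegral_prod_right'
  have hm2 : ∀ L : Fin q → List (Edge d), Measurable fun u => if ∀ k, (L k).headD e₀ = e₀ then
      ((multiArcs e₀ L).map fun c => killed Z B u c.1 c.2).prod else 0 := fun L => by
    by_cases hL : ∀ k, (L k).headD e₀ = e₀
    · simp only [if_pos hL]; exact hmk _
    · simp only [if_neg hL]; exact measurable_const
  have hbeta := lintegral_betaMeasure (c := 0) (e := -(q : ℝ)) (ha e₀) hh (by simpa using ha e₀)
    (by linarith)
  rw [add_zero, ← sub_eq_add_neg] at hbeta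
  simp only [greenSum_pow, ← ENNReal.tsum_mul_left]
  refine (le_of_eq ((lintegral_tsum fun L => (hmt.mul (hm2 L)).aemeasurable).trans
    (tsum_congr hterm))).trans ?_
  rw [ENNReal.tsum_mul_left, ← hbeta]
  refine mul_le_mul' le_rfl ?_
  refine (le_of_eq (lintegral_tsum fun L => (hm3 L).aemeasurable).symm).trans ?_
  refine lintegral_mono_ae ?_
  filter_upwards [ae_betaMeasure_mem_Ioo (a e₀) h] with y hy
  refine (le_of_eq (lintegral_tsum fun L =>
    ((hm1 L).comp (measurable_const.prodMk measurable_id)).aemeasurable).symm).trans ?_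
  refine (lintegral_mono fun v => ?_).trans (le_of_eq ((lintegral_const _).trans
    (by rw [measure_univ, mul_one])))
  exact (greenSum_pow (reversedKilled Z B e₀ (y, v)) e₀ q).symm.le.trans
    (greenSum_reversedKilled_pow_le hZ B e₀ hy v q)

end ReversalBound

/-! ### A unit flow of finite energy -/

section Flow

variable {d : ℕ}

/-- The mass of each point of the `n`-th layer `{y ∈ ℕ^d : |y| = n}` under the uniform
distribution. -/
noncomputable def layerMass (d n : ℕ) : ℝ := 1 / ((n + d - 1).choose (d - 1) : ℝ)

/-- The amount of flow through the point `y`: the uniform distribution on the layers of the orthant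
`ℕ^d`, and `0` outside the orthant. -/
noncomputable def coneMass (y : Fin d → ℤ) : ℝ :=
  if ∀ i, 0 ≤ y i then layerMass d (∑ i, y i).toNat else 0

/-- The flow of Pólya's urn, started from the vertex `z`: the unit flow which goes from `z + y` to
`z + y + e_i` in proportion to `y_i + 1`, for `y` in the orthant `ℕ^d`. -/
noncomputable def urnFlow (z : Fin d → ℤ) (e : Edge d) : ℝ :=
  match e with
  | (x, (i, true)) => coneMass (x - z) * (((x - z) i + 1 : ℤ) / ((∑ k, (x - z) k : ℤ) + d))
  | (_, (_, false)) => 0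

lemma layerMass_pos (hd : 1 ≤ d) (n : ℕ) : 0 < layerMass d n := by
  have : 0 < (n + d - 1).choose (d - 1) := Nat.choose_pos (by omega)
  unfold layerMass
  positivity

lemma layerMass_zero : layerMass d 0 = 1 := by
  simp [layerMass]

lemma layerMass_succ (hd : 1 ≤ d) (n : ℕ) :
    layerMass d (n + 1) = layerMass d n * ((n + 1) / (n + d)) := by
  obtain ⟨k, rfl⟩ : ∃ k, d = k + 1 := ⟨d - 1, by omega⟩
  unfold layerMass
  simp only [Nat.add_sub_cancel, show n + 1 + (k + 1) - 1 = n + k + 1 by omega,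
    show n + (k + 1) - 1 = n + k by omega]
  have h := Nat.choose_mul_succ_eq (n + k) k
  rw [show n + k + 1 - k = n + 1 by omega] at h
  have h1 : 0 < (n + k).choose k := Nat.choose_pos (by omega)
  have h2 : 0 < (n + k + 1).choose k := Nat.choose_pos (by omega)
  have h' : ((n + k).choose k : ℝ) * (n + k + 1) = ((n + k + 1).choose k : ℝ) * (n + 1) := by
    exact_mod_cast h
  have h3 : (0 : ℝ) < (n + k).choose k := by exact_mod_cast h1
  have h4 : (0 : ℝ) < (n + k + 1).choose k := by exact_mod_cast h2
  push_cast
  rw [div_mul_div_comm, div_eq_div_iff h4.ne' (by positivity)]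
  linarith

lemma coneMass_nonneg (hd : 1 ≤ d) (y : Fin d → ℤ) : 0 ≤ coneMass y := by
  unfold coneMass
  split_ifs
  · exact (layerMass_pos hd _).le
  · exact le_rfl

lemma layerMass_le_one (hd : 1 ≤ d) (n : ℕ) : layerMass d n ≤ 1 := by
  have : 0 < (n + d - 1).choose (d - 1) := Nat.choose_pos (by omega)
  unfold layerMass
  rw [div_le_one (by exact_mod_cast this)]
  exact_mod_cast this

lemma coneMass_le_one (hd : 1 ≤ d) (y : Fin d → ℤ) : coneMass y ≤ 1 := by
  unfold coneMass
  split_ifs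
  · exact layerMass_le_one hd _
  · exact zero_le_one

lemma urnFlow_nonneg (hd : 1 ≤ d) (z : Fin d → ℤ) (e : Edge d) : 0 ≤ urnFlow z e := by
  obtain ⟨x, i, b⟩ := e
  cases b
  · exact le_rfl
  · simp only [urnFlow, coneMass]
    split_ifs with h
    · have h1 : 0 ≤ ∑ k, (x - z) k := Finset.sum_nonneg fun k _ => h k
      have h2 : (0 : ℝ) ≤ ((x - z) i + 1 : ℤ) := by exact_mod_cast (by linarith [h i])
      have h3 : (0 : ℝ) ≤ (∑ k, (x - z) k : ℤ) := by exact_mod_cast h1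
      exact mul_nonneg (layerMass_pos hd _).le (div_nonneg h2 (by positivity))
    · simp

/-- The flow out of a vertex. -/
lemma sum_urnFlow_out (hd : 1 ≤ d) (z x : Fin d → ℤ) :
    ∑ j, urnFlow z (x, j) = coneMass (x - z) := by
  rw [Fintype.sum_prod_type]
  simp only [Fintype.sum_bool, urnFlow, add_zero]
  rw [← Finset.mul_sum, ← Finset.sum_div]
  by_cases h : ∀ i, 0 ≤ (x - z) i
  · have h1 : 0 ≤ ∑ k, (x - z) k := Finset.sum_nonneg fun k _ => h k
    have h3 : (0 : ℝ) ≤ (∑ k, (x - z) k : ℤ) := by exact_mod_cast h1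
    have hd' : (0 : ℝ) < d := by exact_mod_cast hd
    have h2 : ∑ i, (((x - z) i + 1 : ℤ) : ℝ) = (∑ k, (x - z) k : ℤ) + d := by
      push_cast
      rw [Finset.sum_add_distrib]
      simp
    rw [h2, div_self (by positivity), mul_one]
  · rw [coneMass, if_neg h, zero_mul]

/-- The flow into a vertex, to which the source `z` contributes one unit. -/
lemma sum_urnFlow_in (hd : 1 ≤ d) (z x : Fin d → ℤ) :
    ∑ i, urnFlow z (headDir.symm (x, i)) + (if x = z then 1 else 0) = coneMass (x - z) := by
  rw [Fintype.sum_prod_type]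
  have hhd : ∀ i b, headDir.symm (x, ((i, b) : Dir d)) = (x - dirVec (i, b), (i, b)) :=
    fun _ _ => rfl
  simp only [Fintype.sum_bool, hhd, urnFlow, add_zero, dirVec]
  set y := x - z with hy
  have hxy : ∀ i, x - Pi.single i 1 - z = y - Pi.single i 1 := fun i => by rw [hy]; abel
  simp only [hxy]
  have hxz : x = z ↔ y = 0 := by rw [hy, sub_eq_zero]
  simp only [hxz]
  have hsum : ∀ i, ∑ k, (y - (Pi.single i 1 : Fin d → ℤ)) k = ∑ k, y k - 1 := fun i => by
    simp [Finset.sum_sub_distrib]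
  have hself : ∀ i, (y - (Pi.single i 1 : Fin d → ℤ)) i + 1 = y i := fun i => by simp
  simp only [hsum, hself]
  by_cases h : ∀ i, 0 ≤ y i
  · obtain ⟨n, hn⟩ : ∃ n : ℕ, ∑ k, y k = n := ⟨(∑ k, y k).toNat, by
      rw [Int.toNat_of_nonneg (Finset.sum_nonneg fun k _ => h k)]⟩
    -- A neighbour `y - e_i` outside the orthant has `y i = 0`, so its mass does not matter.
    have hterm : ∀ i,
        coneMass (y - Pi.single i 1) * (((y i : ℤ) : ℝ) / (((∑ k, y k - 1 : ℤ) : ℝ) + d))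
        = layerMass d (n - 1) * (((y i : ℤ) : ℝ) / (((∑ k, y k - 1 : ℤ) : ℝ) + d)) := by
      intro i
      rcases (h i).lt_or_eq with hi | hi
      · congr 1
        rw [coneMass, if_pos, hsum, hn]
        · congr 1
          omega
        · intro k
          by_cases hk : k = i
          · subst hk; simp; omega
          · simpa [hk] using h k
      · simp [← hi]
    simp only [hterm]
    rw [← Finset.mul_sum, ← Finset.sum_div, ← Int.cast_sum, hn, coneMass, if_pos h, hn]
    simp only [Int.toNat_natCast, Int.cast_natCast]
    rcases n with _ | n
    · have : y = 0 := by
        funext i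
        have := (Finset.sum_eq_zero_iff_of_nonneg fun k _ => h k).1 (by simpa using hn) i
          (Finset.mem_univ i)
        simpa using this
      simp [this, layerMass_zero]
    · have : y ≠ 0 := by
        rintro h0
        rw [h0] at hn
        simp at hn
        omega
      rw [if_neg this, add_zero, layerMass_succ hd]
      simp
  · have h0 : y ≠ 0 := fun h0 => h (by simp [h0])
    have hterm : ∀ i, coneMass (y - Pi.single i 1) = 0 := by
      intro i
      rw [coneMass, if_neg]
      intro hc
      refine h fun k => ?_
      have := hc k
      by_cases hk : k = i
      · subst hk; simp at this; omega
      · simpa [hk] using this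
    simp only [hterm, zero_mul, Finset.sum_const_zero, if_neg h0]
    rw [coneMass, if_neg h, add_zero]

/-- In dimension at least three the energy of the flow is finite: the `n`-th layer consists of
`1 / layerMass d n` points, hence its energy is `layerMass d n = O(n⁻²)`. -/
lemma summable_coneMass_sq (hd : 3 ≤ d) : Summable fun y : Fin d → ℤ => coneMass y ^ 2 := by
  have hd1 : 1 ≤ d := by omega
  have hbound : ∀ n, layerMass d n ≤ 2 * (1 / ((n : ℝ) + 1) ^ 2) := by
    intro n
    have h1 : (n + 2).choose 2 ≤ (n + d - 1).choose (d - 1) := by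
      rw [Nat.choose_symm_of_eq_add (show n + 2 = 2 + n by omega),
        Nat.choose_symm_of_eq_add (show n + d - 1 = (d - 1) + n by omega)]
      exact Nat.choose_le_choose n (by omega)
    have h2 : ((n + 2).choose 2 : ℝ) = (n + 2) * (n + 1) / 2 := by
      rw [Nat.cast_choose_two]
      push_cast
      ring
    have h3 : ((n : ℝ) + 1) ^ 2 / 2 ≤ ((n + d - 1).choose (d - 1) : ℝ) := by
      have h4 : ((n + 2).choose 2 : ℝ) ≤ ((n + d - 1).choose (d - 1) : ℝ) := by exact_mod_cast h1
      refine le_trans ?_ h4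
      rw [h2]
      have : (0 : ℝ) ≤ n := Nat.cast_nonneg n
      nlinarith
    calc layerMass d n ≤ 1 / (((n : ℝ) + 1) ^ 2 / 2) :=
          one_div_le_one_div_of_le (by positivity) h3
      _ = _ := by field_simp
  have hsum : Summable fun n : ℕ => layerMass d n := by
    refine Summable.of_nonneg_of_le (fun n => (layerMass_pos hd1 n).le) hbound
      (Summable.mul_left _ ?_)
    exact_mod_cast (summable_nat_add_iff 1).2
      (Real.summable_one_div_nat_pow.2 (by norm_num : 1 < 2))
  refine summable_of_sum_le (c := ∑' n, layerMass d n) (fun y => sq_nonneg _) fun S => ?_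
  let N : (Fin d → ℤ) → ℕ := fun y => (∑ i, y i).toNat
  have hcard : ∀ n, ((S.filter fun y => ∀ i, 0 ≤ y i).filter fun y => N y = n).card
      ≤ (n + d - 1).choose (d - 1) := by
    intro n
    have h1 := Finset.card_finsuppAntidiag_nat_eq_choose (s := (Finset.univ : Finset (Fin d))) n
    have h2 : (Finset.finsuppAntidiag (Finset.univ : Finset (Fin d)) n).card
        = (n + d - 1).choose (d - 1) := by
      rw [h1, Finset.card_univ, Fintype.card_fin, add_comm d n]
      exact (Nat.choose_symm_of_eq_add (by omega)).symm
    rw [← h2]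
    refine Finset.card_le_card_of_injOn
      (fun y => Finsupp.equivFunOnFinite.symm fun i => (y i).toNat) ?_ ?_
    · intro y hy
      simp only [Finset.coe_filter, Finset.mem_filter, Set.mem_ofPred_eq, N] at hy
      simp only [SetLike.mem_coe, Finset.mem_finsuppAntidiag, Finset.subset_univ, and_true,
        Finsupp.equivFunOnFinite_symm_apply_apply]
      rw [← hy.2]
      zify
      rw [Int.toNat_of_nonneg (Finset.sum_nonneg fun k _ => hy.1.2 k)]
      exact Finset.sum_congr rfl fun k _ => by simp [hy.1.2 k]
    · intro y hy y' hy' hyy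
      simp only [Finset.coe_filter, Finset.mem_filter, Set.mem_ofPred_eq] at hy hy'
      funext i
      have := DFunLike.congr_fun hyy i
      simp only [Finsupp.equivFunOnFinite_symm_apply_apply] at this
      have h1 := hy.1.2 i
      have h2 := hy'.1.2 i
      omega
  have hS : ∑ y ∈ S, coneMass y ^ 2
      = ∑ y ∈ S.filter fun y => ∀ i, 0 ≤ y i, layerMass d (N y) ^ 2 := by
    rw [Finset.sum_filter]
    refine Finset.sum_congr rfl fun y _ => ?_
    rw [coneMass]
    split_ifs <;> simp [N]
  rw [hS, ← Finset.sum_fiberwise_of_maps_to (t := (S.filter fun y => ∀ i, 0 ≤ y i).image N)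
    fun y hy => Finset.mem_image_of_mem N hy]
  refine le_trans (Finset.sum_le_sum fun n _ => ?_)
    (hsum.sum_le_tsum _ fun n _ => (layerMass_pos hd1 n).le)
  calc ∑ y ∈ (S.filter fun y => ∀ i, 0 ≤ y i).filter fun y => N y = n, layerMass d (N y) ^ 2
      = ∑ y ∈ (S.filter fun y => ∀ i, 0 ≤ y i).filter fun y => N y = n, layerMass d n ^ 2 :=
        Finset.sum_congr rfl fun y hy => by rw [(Finset.mem_filter.1 hy).2]
    _ = (((S.filter fun y => ∀ i, 0 ≤ y i).filter fun y => N y = n).card : ℝ) *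
          layerMass d n ^ 2 := by rw [Finset.sum_const, nsmul_eq_mul]
    _ ≤ ((n + d - 1).choose (d - 1) : ℝ) * layerMass d n ^ 2 := by
        gcongr
        exact_mod_cast hcard n
    _ = layerMass d n := by
        have h1 : 0 < (n + d - 1).choose (d - 1) := Nat.choose_pos (by omega)
        have h2 : (0 : ℝ) < (n + d - 1).choose (d - 1) := by exact_mod_cast h1
        unfold layerMass
        field_simp

end Flow

/-! ### Small tilts -/

section SmallTilts

variable {ι : Type*} [Fintype ι] [DecidableEq ι]

omit [DecidableEq ι] in
lemma exists_abs_log_mulVec_le [Nonempty ι] {Z : Matrix ι ι ℝ} (hZ : ∀ j i, 0 < Z j i) :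
    ∃ K : ℝ, 0 ≤ K ∧ ∀ (u : OpenSimplex ι) (j : ι), |Real.log ((Z *ᵥ u.1) j)| ≤ K := by
  obtain ⟨p, hp⟩ := Finite.exists_min fun p : ι × ι => Z p.1 p.2
  obtain ⟨q, hq⟩ := Finite.exists_max fun p : ι × ι => Z p.1 p.2
  refine ⟨|Real.log (Z p.1 p.2)| + |Real.log (Z q.1 q.2)|, by positivity, fun u j => ?_⟩
  have h1 : Z p.1 p.2 ≤ (Z *ᵥ u.1) j := by
    calc Z p.1 p.2 = ∑ i, Z p.1 p.2 * u.1 i := by rw [← Finset.mul_sum, u.2.2, mul_one]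
      _ ≤ _ := Finset.sum_le_sum fun i _ => mul_le_mul_of_nonneg_right (hp (j, i)) (u.2.1 i).le
  have h2 : (Z *ᵥ u.1) j ≤ Z q.1 q.2 := by
    calc (Z *ᵥ u.1) j ≤ ∑ i, Z q.1 q.2 * u.1 i :=
          Finset.sum_le_sum fun i _ => mul_le_mul_of_nonneg_right (hq (j, i)) (u.2.1 i).le
      _ = Z q.1 q.2 := by rw [← Finset.mul_sum, u.2.2, mul_one]
  have h3 := Real.log_le_log (hZ _ _) h1
  have h4 := Real.log_le_log (mulVec_pos hZ u j) h2
  rw [abs_le]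
  constructor
  · linarith [neg_abs_le (Real.log (Z p.1 p.2)), abs_nonneg (Real.log (Z q.1 q.2))]
  · linarith [le_abs_self (Real.log (Z q.1 q.2)), abs_nonneg (Real.log (Z p.1 p.2))]

lemma exp_le_one_add_add_sq_mul_exp (y : ℝ) :
    Real.exp y ≤ 1 + y + y ^ 2 * Real.exp |y| := by
  have h := Complex.norm_exp_sub_sum_le_norm_mul_exp y 2
  have h1 : Complex.exp y - ∑ m ∈ Finset.range 2, (y : ℂ) ^ m / m.factorial
      = ((Real.exp y - (1 + y) : ℝ) : ℂ) := by
    simp [Finset.sum_range_succ]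
  rw [h1, Complex.norm_real, Complex.norm_real, Real.norm_eq_abs, Real.norm_eq_abs, sq_abs] at h
  linarith [(abs_le.1 h).2]

omit [DecidableEq ι] in
lemma monomial_mul_eq_exp {Z : Matrix ι ι ℝ} (hZ : ∀ j i, 0 < Z j i) (x y : ι → ℝ) (r : ℝ)
    (u : OpenSimplex ι) :
    monomial Z (fun i => r * x i) (fun j => r * y j) u
      = Real.exp (r * ∑ i, (x i * Real.log (u.1 i) - y i * Real.log ((Z *ᵥ u.1) i))) := by
  rw [monomial, Finset.mul_sum, Real.exp_sum, ← Finset.prod_mul_distrib]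
  refine Finset.prod_congr rfl fun i _ => ?_
  rw [Real.rpow_def_of_pos (u.2.1 i), Real.rpow_def_of_pos (mulVec_pos hZ u i), ← Real.exp_add]
  congr 1
  ring

/-- Moments of a monomial with small exponents: up to an error of second order, they are the
exponential of a quantity `r * E` which is linear in the exponent `r`. -/
lemma exists_lintegral_monomial_le (i₀ : ι) {α : ι → ℝ} {Z : Matrix ι ι ℝ} (hα : ∀ i, 0 < α i)
    (hZ : ∀ j i, 0 < Z j i) :
    ∃ δ > 0, ∃ C ≥ 0, ∀ (x y : ι → ℝ) (m : ℝ), (∀ i, |x i| ≤ m) → (∀ i, |y i| ≤ m) →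
      ∃ E : ℝ, ∀ r : ℝ, |r| * m ≤ δ →
        ∫⁻ u, ENNReal.ofReal (monomial Z (fun i => r * x i) (fun j => r * y j) u)
            ∂(hyperLaw i₀ α α Z)
          ≤ ENNReal.ofReal (Real.exp (r * E + C * (r * m) ^ 2)) := by
  have : Nonempty ι := ⟨i₀⟩
  have := isProbabilityMeasure_hyperLaw i₀ hα hα hZ
  obtain ⟨K, hK0, hK⟩ := exists_abs_log_mulVec_le hZ
  obtain ⟨k, hk⟩ := Finite.exists_min α
  set δ := α k / 4 with hδ
  have hδ0 : 0 < δ := by have := hα k; positivity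
  set μ := hyperLaw i₀ α α Z with hμ
  -- The logarithm of a monomial with exponents bounded by `m` is at most `m * W`.
  let W : OpenSimplex ι → ℝ := fun u => ∑ i, (K - Real.log (u.1 i))
  have hlog : ∀ (u : OpenSimplex ι) i, Real.log (u.1 i) ≤ 0 := fun u i => by
    refine Real.log_nonpos (u.2.1 i).le ?_
    rw [← u.2.2]
    exact Finset.single_le_sum (fun j _ => (u.2.1 j).le) (Finset.mem_univ i)
  have hW0 : ∀ u, 0 ≤ W u := fun u => Finset.sum_nonneg fun i _ => by linarith [hlog u i]
  have hu : ∀ i, Measurable fun u : OpenSimplex ι => u.1 i := fun i =>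
    (measurable_pi_apply i).comp measurable_subtype_coe
  have hWm : Measurable W :=
    Finset.measurable_sum _ fun i _ => measurable_const.sub (hu i).log
  have hexpW : ∀ u, Real.exp (2 * δ * W u) = Real.exp (2 * δ * Fintype.card ι * K) *
      monomial Z (fun _ => -(2 * δ)) (fun _ => 0) u := by
    intro u
    have h := monomial_mul_eq_exp hZ (fun _ => (-1 : ℝ)) (fun _ => 0) (2 * δ) u
    simp only [mul_neg, mul_one, mul_zero] at h
    rw [h, ← Real.exp_add]
    congr 1
    simp only [W, Finset.sum_sub_distrib, Finset.sum_const, Finset.card_univ, nsmul_eq_mul]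
    simp only [neg_mul, one_mul, zero_mul, Finset.sum_neg_distrib, Finset.sum_const_zero]
    ring
  have hint : Integrable (fun u => Real.exp (2 * δ * W u)) μ := by
    simp only [hexpW]
    refine Integrable.const_mul ⟨(measurable_monomial _ _ _).aestronglyMeasurable, ?_⟩ _
    rw [hasFiniteIntegral_iff_ofReal
        (Filter.Eventually.of_forall fun u => (monomial_pos hZ _ _ u).le),
      lintegral_monomial i₀ hZ]
    refine ENNReal.mul_lt_top (ENNReal.inv_lt_top.2 (pos_iff_ne_zero.2 (hyperInt_ne_zero i₀ hZ)))
      (hyperInt_ne_top i₀ (fun i => ?_) (fun j => ?_) hZ).lt_top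
    · have := hk i
      have := hα k
      simp only [hδ]; linarith
    · simpa using hα j
  set D := ∫ u, Real.exp (2 * δ * W u) ∂μ with hD
  have hD0 : 0 ≤ D := integral_nonneg fun u => (Real.exp_pos _).le
  have hsq : ∀ u, W u ^ 2 * Real.exp (δ * W u) ≤ 2 / δ ^ 2 * Real.exp (2 * δ * W u) := by
    intro u
    have h1 : (δ * W u) ^ 2 / 2 ≤ Real.exp (δ * W u) := by
      have := Real.quadratic_le_exp_of_nonneg (mul_nonneg hδ0.le (hW0 u))
      have := mul_nonneg hδ0.le (hW0 u)
      linarith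
    have h2 : Real.exp (2 * δ * W u) = Real.exp (δ * W u) * Real.exp (δ * W u) := by
      rw [← Real.exp_add]; ring_nf
    calc W u ^ 2 * Real.exp (δ * W u)
        = 2 / δ ^ 2 * ((δ * W u) ^ 2 / 2 * Real.exp (δ * W u)) := by field_simp
      _ ≤ 2 / δ ^ 2 * (Real.exp (δ * W u) * Real.exp (δ * W u)) := by gcongr
      _ = _ := by rw [h2]
  refine ⟨δ, hδ0, 2 / δ ^ 2 * D, by positivity, fun x y m hx hy => ?_⟩
  have hm0 : 0 ≤ m := (abs_nonneg _).trans (hx i₀)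
  let Y : OpenSimplex ι → ℝ :=
    fun u => ∑ i, (x i * Real.log (u.1 i) - y i * Real.log ((Z *ᵥ u.1) i))
  have hYm : Measurable Y := Finset.measurable_sum _ fun i _ => by
    have h1 : Measurable fun u : OpenSimplex ι => (Z *ᵥ u.1) i := by
      simp only [Matrix.mulVec, dotProduct]
      exact Finset.measurable_sum _ fun l _ => (hu l).const_mul _
    exact ((hu i).log.const_mul _).sub (h1.log.const_mul _)
  have hYW : ∀ u, |Y u| ≤ m * W u := by
    intro u
    refine (Finset.abs_sum_le_sum_abs _ _).trans ?_
    simp only [W]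
    rw [Finset.mul_sum]
    refine Finset.sum_le_sum fun i _ => ?_
    refine (abs_sub _ _).trans ?_
    rw [abs_mul, abs_mul, abs_of_nonpos (hlog u i)]
    have h1 := mul_le_mul_of_nonneg_right (hx i) (neg_nonneg.2 (hlog u i))
    have h2 := mul_le_mul (hy i) (hK u i) (abs_nonneg _) hm0
    linarith
  have hYint : Integrable Y μ := by
    refine Integrable.mono' (hint.const_mul (m * (1 / (2 * δ)))) hYm.aestronglyMeasurable
      (Filter.Eventually.of_forall fun u => (hYW u).trans ?_)
    have h1 := Real.add_one_le_exp (2 * δ * W u)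
    rw [mul_assoc]
    refine mul_le_mul_of_nonneg_left ?_ hm0
    rw [div_mul_eq_mul_div, one_mul, le_div_iff₀ (by positivity)]
    linarith
  refine ⟨∫ u, Y u ∂μ, fun r hr => ?_⟩
  -- Taylor's formula of second order; in the error term `exp |r * Y|` is at most `exp (δ * W)`.
  have hbd : ∀ u, Real.exp (r * Y u)
      ≤ 1 + r * Y u + (r * m) ^ 2 * (2 / δ ^ 2) * Real.exp (2 * δ * W u) := by
    intro u
    refine (exp_le_one_add_add_sq_mul_exp _).trans ?_
    have h1 : |r * Y u| ≤ (|r| * m) * W u := by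
      rw [abs_mul, mul_assoc]
      exact mul_le_mul_of_nonneg_left (hYW u) (abs_nonneg _)
    have h2 : |r * Y u| ≤ δ * W u := h1.trans (mul_le_mul_of_nonneg_right hr (hW0 u))
    have h3 : (r * Y u) ^ 2 ≤ (r * m) ^ 2 * W u ^ 2 := by
      rw [← mul_pow, ← sq_abs (r * Y u), ← sq_abs (r * m * W u)]
      refine pow_le_pow_left₀ (abs_nonneg _) (h1.trans (le_of_eq ?_)) 2
      rw [abs_mul, abs_mul, abs_of_nonneg hm0, abs_of_nonneg (hW0 u)]
    have h4 : (r * Y u) ^ 2 * Real.exp |r * Y u|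
        ≤ ((r * m) ^ 2 * W u ^ 2) * Real.exp (δ * W u) :=
      mul_le_mul h3 (Real.exp_le_exp.2 h2) (Real.exp_pos _).le (by positivity)
    have h5 := mul_le_mul_of_nonneg_left (hsq u) (sq_nonneg (r * m))
    nlinarith
  have hint2 : Integrable (fun u => 1 + r * Y u +
      (r * m) ^ 2 * (2 / δ ^ 2) * Real.exp (2 * δ * W u)) μ :=
    ((integrable_const 1).add (hYint.const_mul r)).add (hint.const_mul _)
  calc ∫⁻ u, ENNReal.ofReal (monomial Z (fun i => r * x i) (fun j => r * y j) u) ∂μ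
      ≤ ∫⁻ u, ENNReal.ofReal (1 + r * Y u +
          (r * m) ^ 2 * (2 / δ ^ 2) * Real.exp (2 * δ * W u)) ∂μ := by
        refine lintegral_mono fun u => ENNReal.ofReal_le_ofReal ?_
        rw [monomial_mul_eq_exp hZ]
        exact hbd u
    _ = ENNReal.ofReal (∫ u, (1 + r * Y u +
          (r * m) ^ 2 * (2 / δ ^ 2) * Real.exp (2 * δ * W u)) ∂μ) :=
        (ofReal_integral_eq_lintegral_ofReal hint2 (Filter.Eventually.of_forall fun u =>
          (Real.exp_pos _).le.trans (hbd u))).symm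
    _ ≤ _ := by
        refine ENNReal.ofReal_le_ofReal ?_
        have h1 : ∫ u, (1 + r * Y u +
            (r * m) ^ 2 * (2 / δ ^ 2) * Real.exp (2 * δ * W u)) ∂μ
            = 1 + r * ∫ u, Y u ∂μ + (r * m) ^ 2 * (2 / δ ^ 2) * D := by
          rw [integral_add (f := fun u => 1 + r * Y u)
              ((integrable_const 1).add (hYint.const_mul r)) (hint.const_mul _),
            integral_add (integrable_const 1) (hYint.const_mul r), integral_const_mul,
            integral_const_mul]
          simp [hD]
        rw [h1]
        refine le_trans (le_of_eq ?_) (Real.add_one_le_exp _)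
        ring

end SmallTilts

/-! ### Tilting along the flow -/

section FlowTilt

/-- Finitely many exceptional factors do not affect the boundedness of the finite products. -/
lemma exists_prod_le_of_summable {V : Type*} {f : V → ℝ≥0∞} {c : V → ℝ} (hf : ∀ x, f x ≠ ∞)
    (hc : Summable c) (hc0 : ∀ x, 0 ≤ c x)
    (h : ∀ᶠ x in Filter.cofinite, f x ≤ ENNReal.ofReal (Real.exp (c x))) :
    ∃ C : ℝ≥0∞, C ≠ ∞ ∧ ∀ B : Finset V, ∏ x ∈ B, f x ≤ C := by
  classical
  have hS : {x | ¬ f x ≤ ENNReal.ofReal (Real.exp (c x))}.Finite := h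
  let S := hS.toFinset
  refine ⟨(∏ x ∈ S, (1 + f x)) * ENNReal.ofReal (Real.exp (∑' x, c x)),
    ENNReal.mul_ne_top (ENNReal.prod_ne_top fun x _ =>
      ENNReal.add_ne_top.2 ⟨ENNReal.one_ne_top, hf x⟩) ENNReal.ofReal_ne_top, fun B => ?_⟩
  have h1 : ∀ x, f x ≤ (if x ∈ S then 1 + f x else 1) * ENNReal.ofReal (Real.exp (c x)) := by
    intro x
    by_cases hx : x ∈ S
    · rw [if_pos hx]
      refine le_trans (le_add_self) (le_mul_of_one_le_right' ?_)
      rw [← ENNReal.ofReal_one]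
      exact ENNReal.ofReal_le_ofReal (Real.one_le_exp (hc0 x))
    · rw [if_neg hx, one_mul]
      by_contra hcon
      exact hx (hS.mem_toFinset.2 hcon)
  refine (Finset.prod_le_prod' fun x _ => h1 x).trans ?_
  rw [Finset.prod_mul_distrib, ← ENNReal.ofReal_prod_of_nonneg fun x _ => (Real.exp_pos _).le,
    ← Real.exp_sum]
  gcongr
  · rw [Finset.prod_ite_mem]
    exact Finset.prod_le_prod_of_subset_of_one_le' Finset.inter_subset_right
      fun x _ _ => le_self_add
  · exact hc.sum_le_tsum _ fun x _ => hc0 x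

variable {d : ℕ} [NeZero d]

/-- The parameters obtained by adding to `α` the multiple `h` of the flow started at the head of
`e₀`. -/
noncomputable def outParam (α : Dir d → ℝ) (e₀ : Edge d) (h : ℝ) (e : Edge d) : ℝ :=
  α e.2 + h * urnFlow (head e₀) e

/-- The parameters obtained by adding to `α` the multiple `h` of the flow which is fed into the
head of `e₀` through the edge `e₀`. -/
noncomputable def inParam (α : Dir d → ℝ) (e₀ : Edge d) (h : ℝ) (e : Edge d) : ℝ :=
  α e.2 + h * (urnFlow (head e₀) e + if e = e₀ then 1 else 0)

omit [NeZero d] in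
lemma sum_flowIn (hd : 1 ≤ d) (e₀ : Edge d) (x : Fin d → ℤ) :
    ∑ i, (urnFlow (head e₀) (headDir.symm (x, i)) + if headDir.symm (x, i) = e₀ then 1 else 0)
      = coneMass (x - head e₀) := by
  rw [Finset.sum_add_distrib, ← sum_urnFlow_in hd (head e₀) x]
  congr 1
  have h : ∀ i, headDir.symm (x, i) = e₀ ↔ x = head e₀ ∧ i = e₀.2 := fun i => by
    rw [Equiv.symm_apply_eq, ← Prod.mk.injEq]
    rfl
  simp only [h]
  by_cases hx : x = head e₀ <;> simp [hx]

omit [NeZero d] in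
/-- The parameters are balanced at every vertex, because `urnFlow` is a unit flow from the head of
`e₀`. -/
lemma sum_outParam_eq_sum_inParam (hd : 1 ≤ d) (α : Dir d → ℝ) (e₀ : Edge d) (h : ℝ)
    (x : Fin d → ℤ) :
    ∑ j, outParam α e₀ h (x, j) = ∑ i, inParam α e₀ h (headDir.symm (x, i)) := by
  simp only [outParam, inParam]
  rw [Finset.sum_add_distrib, Finset.sum_add_distrib, ← Finset.mul_sum, ← Finset.mul_sum,
    sum_urnFlow_out hd, sum_flowIn hd]
  rfl

omit [NeZero d] in
lemma urnFlow_out_mem (hd : 1 ≤ d) (z x : Fin d → ℤ) (j : Dir d) :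
    0 ≤ urnFlow z (x, j) ∧ urnFlow z (x, j) ≤ coneMass (x - z) := by
  refine ⟨urnFlow_nonneg hd z _, ?_⟩
  rw [← sum_urnFlow_out hd z x]
  exact Finset.single_le_sum (f := fun j => urnFlow z (x, j)) (fun j _ => urnFlow_nonneg hd z _)
    (Finset.mem_univ j)

omit [NeZero d] in
lemma flowIn_mem (hd : 1 ≤ d) (e₀ : Edge d) (x : Fin d → ℤ) (i : Dir d) :
    0 ≤ urnFlow (head e₀) (headDir.symm (x, i)) +
      (if headDir.symm (x, i) = e₀ then (1 : ℝ) else 0) ∧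
    urnFlow (head e₀) (headDir.symm (x, i)) + (if headDir.symm (x, i) = e₀ then (1 : ℝ) else 0)
      ≤ coneMass (x - head e₀) := by
  have h0 : ∀ i, 0 ≤ urnFlow (head e₀) (headDir.symm (x, i)) +
      (if headDir.symm (x, i) = e₀ then (1 : ℝ) else 0) := fun i =>
    add_nonneg (urnFlow_nonneg hd _ _) (by split_ifs <;> norm_num)
  refine ⟨h0 i, ?_⟩
  rw [← sum_flowIn hd e₀ x]
  exact Finset.single_le_sum (f := fun i => urnFlow (head e₀) (headDir.symm (x, i)) +
    (if headDir.symm (x, i) = e₀ then (1 : ℝ) else 0)) (fun j _ => h0 j) (Finset.mem_univ i)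

lemma add_mul_pos_of_mem_Icc {a h t : ℝ} (ha : 0 < a) (hh : -a < h) (ht0 : 0 ≤ t) (ht1 : t ≤ 1) :
    0 < a + h * t := by
  rcases le_or_gt 0 h with h0 | h0
  · positivity
  · nlinarith

omit [NeZero d] in
lemma outParam_pos (hd : 1 ≤ d) {α : Dir d → ℝ} (hα : ∀ i, 0 < α i) (e₀ : Edge d) {h : ℝ}
    (hh : ∀ i, -α i < h) (e : Edge d) : 0 < outParam α e₀ h e := by
  have h1 := urnFlow_out_mem hd (head e₀) e.1 e.2
  exact add_mul_pos_of_mem_Icc (hα _) (hh _) h1.1 (h1.2.trans (coneMass_le_one hd _))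

omit [NeZero d] in
lemma inParam_pos (hd : 1 ≤ d) {α : Dir d → ℝ} (hα : ∀ i, 0 < α i) (e₀ : Edge d) {h : ℝ}
    (hh : ∀ i, -α i < h) (e : Edge d) : 0 < inParam α e₀ h e := by
  have h1 := flowIn_mem hd e₀ (headDir e).1 (headDir e).2
  rw [Prod.mk.eta, Equiv.symm_apply_apply] at h1
  exact add_mul_pos_of_mem_Icc (hα _) (hh _) h1.1 (h1.2.trans (coneMass_le_one hd _))

lemma tiltMass_ne_top (hd : 1 ≤ d) {α : Dir d → ℝ} {Z : Matrix (Dir d) (Dir d) ℝ}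
    (hα : ∀ i, 0 < α i) (hZ : ∀ i j, 0 < Z i j) (e₀ : Edge d) {h : ℝ} (hh : ∀ i, -α i < h)
    (x : Fin d → ℤ) : tiltMass α (outParam α e₀ h) (inParam α e₀ h) Z x ≠ ∞ :=
  ENNReal.mul_ne_top (ENNReal.inv_ne_top.2 (hyperInt_ne_zero _ hZ))
    (hyperInt_ne_top _ (fun _ => outParam_pos hd hα e₀ hh _)
      (fun _ => inParam_pos hd hα e₀ hh _) hZ)

omit [NeZero d] in
lemma tilt_outParam_inParam (α : Dir d → ℝ) (Z : Matrix (Dir d) (Dir d) ℝ) (e₀ : Edge d) (h : ℝ)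
    (x : Fin d → ℤ) :
    tilt α (outParam α e₀ h) (inParam α e₀ h) Z x
      = monomial Z (fun j => h * urnFlow (head e₀) (x, j))
          (fun i => h * (urnFlow (head e₀) (headDir.symm (x, i)) +
            if headDir.symm (x, i) = e₀ then 1 else 0)) := by
  have h1 : ∀ i, (headDir.symm (x, i)).2 = i := fun _ => rfl
  simp only [tilt, outParam, inParam, h1, add_sub_cancel_left]

/-- The exponents `h = t * P` and `h = -(t * Q)` have opposite first order effects, and the second
order effects are bounded by the energy of the flow. -/
lemma exists_prod_tiltMass_le (hd : 3 ≤ d) {α : Dir d → ℝ} {Z : Matrix (Dir d) (Dir d) ℝ}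
    (hα : ∀ i, 0 < α i) (hZ : ∀ i j, 0 < Z i j) (e₀ : Edge d) {t P Q : ℝ} (ht : 0 < t)
    (hPQ : P.HolderConjugate Q) (hQ : ∀ i, t * Q < α i) :
    ∃ C : ℝ≥0∞, C ≠ ∞ ∧ ∀ B : Finset (Fin d → ℤ), ∏ x ∈ B,
      (tiltMass α (outParam α e₀ (t * P)) (inParam α e₀ (t * P)) Z x ^ (1 / P) *
        tiltMass α (outParam α e₀ (-(t * Q))) (inParam α e₀ (-(t * Q))) Z x ^ (1 / Q)) ≤ C := by
  have hd1 : 1 ≤ d := by omega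
  have hP0 := hPQ.pos
  have hQ0 := hPQ.symm.pos
  obtain ⟨δ, hδ, C, hC, hmain⟩ := exists_lintegral_monomial_le ((0, true) : Dir d) hα hZ
  have hsum : Summable fun x : Fin d → ℤ => coneMass (x - head e₀) ^ 2 :=
    ((Equiv.subRight (head e₀)).summable_iff (f := fun y => coneMass y ^ 2)).2
      (summable_coneMass_sq hd)
  refine exists_prod_le_of_summable
    (c := fun x => C * t ^ 2 * (P + Q) * coneMass (x - head e₀) ^ 2) (fun x => ?_)
    (hsum.mul_left _) (fun x => by positivity) ?_
  · have hP' : ∀ i, -α i < t * P := fun i => by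
      have := hα i
      have : 0 < t * P := by positivity
      linarith
    have hQ' : ∀ i, -α i < -(t * Q) := fun i => by linarith [hQ i]
    exact ENNReal.mul_ne_top
      (ENNReal.rpow_ne_top_of_nonneg (by positivity) (tiltMass_ne_top hd1 hα hZ e₀ hP' x))
      (ENNReal.rpow_ne_top_of_nonneg (by positivity) (tiltMass_ne_top hd1 hα hZ e₀ hQ' x))
  · have hlim := hsum.tendsto_cofinite_zero
    have hε : 0 < (δ / (t * (P + Q))) ^ 2 := by positivity
    filter_upwards [hlim.eventually (gt_mem_nhds hε)] with x hx
    have hm0 := coneMass_nonneg hd1 (x - head e₀)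
    have hm := (pow_lt_pow_iff_left₀ hm0 (by positivity) two_ne_zero).1 hx
    rw [lt_div_iff₀ (by positivity)] at hm
    set m := coneMass (x - head e₀) with hmdef
    obtain ⟨E, hE⟩ := hmain (fun j => urnFlow (head e₀) (x, j))
      (fun i => urnFlow (head e₀) (headDir.symm (x, i)) +
        if headDir.symm (x, i) = e₀ then 1 else 0) m
      (fun j => by
        have h := urnFlow_out_mem hd1 (head e₀) x j
        rw [abs_of_nonneg h.1]
        exact h.2)
      (fun i => by
        have h := flowIn_mem hd1 e₀ x i
        rw [abs_of_nonneg h.1]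
        exact h.2)
    have hbd : ∀ r : ℝ, |r| * m ≤ δ →
        tiltMass α (outParam α e₀ r) (inParam α e₀ r) Z x
          ≤ ENNReal.ofReal (Real.exp (r * E + C * (r * m) ^ 2)) := fun r hr => by
      rw [← lintegral_tilt hZ, tilt_outParam_inParam]
      exact hE r hr
    have h1 := hbd (t * P) (by
      rw [abs_of_pos (by positivity)]
      nlinarith [mul_nonneg (mul_nonneg ht.le hQ0.le) hm0])
    have h2 := hbd (-(t * Q)) (by
      rw [abs_neg, abs_of_pos (by positivity)]
      nlinarith [mul_nonneg (mul_nonneg ht.le hP0.le) hm0])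
    calc _ ≤ ENNReal.ofReal (Real.exp (t * P * E + C * (t * P * m) ^ 2)) ^ (1 / P) *
          ENNReal.ofReal (Real.exp (-(t * Q) * E + C * (-(t * Q) * m) ^ 2)) ^ (1 / Q) := by
          gcongr
      _ = _ := by
          rw [ENNReal.ofReal_rpow_of_pos (Real.exp_pos _), ENNReal.ofReal_rpow_of_pos
            (Real.exp_pos _), ← ENNReal.ofReal_mul (by positivity), ← Real.exp_mul,
            ← Real.exp_mul, ← Real.exp_add]
          congr 2
          field_simp
          ring

end FlowTilt

/-! ### Moments of the Green function -/

section Killing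

variable {d : ℕ} {Z : Matrix (Dir d) (Dir d) ℝ}

lemma pathWeight_mono {V : Type*} {M N : V → V → ℝ≥0∞} (h : ∀ e f, M e f ≤ N e f) (e : V)
    (l : List V) : pathWeight M e l ≤ pathWeight N e l := by
  induction l with
  | nil => simp [pathWeight_nil]
  | cons f l ih => simp only [pathWeight_cons]; exact mul_le_mul' (h _ _) ih

lemma killed_mono {B B' : Finset (Fin d → ℤ)} (h : B ⊆ B')
    (u : (Fin d → ℤ) → OpenSimplex (Dir d)) (e f : Edge d) :
    killed Z B u e f ≤ killed Z B' u e f := by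
  unfold killed
  split_ifs with h1 h2
  · exact le_rfl
  · exact absurd ⟨h1.1, h h1.2⟩ h2
  · exact zero_le
  · exact le_rfl

lemma greenSum_killed_mono (u : (Fin d → ℤ) → OpenSimplex (Dir d)) (e f : Edge d) :
    Monotone fun B : Finset (Fin d → ℤ) => greenSum (killed Z B u) e f := by
  intro B B' h
  refine ENNReal.tsum_le_tsum fun l => ?_
  split_ifs
  · exact pathWeight_mono (killed_mono h u) e l
  · exact le_rfl

lemma pathWeight_transition_eq (hZ : ∀ i j, 0 < Z i j) {B : Finset (Fin d → ℤ)}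
    (u : (Fin d → ℤ) → OpenSimplex (Dir d)) (e : Edge d) {l : List (Edge d)}
    (hl : ∀ f ∈ l, f.1 ∈ B) :
    pathWeight (transition (toEnvironment Z hZ u)) e l = pathWeight (killed Z B u) e l := by
  induction l with
  | nil => simp [pathWeight_nil]
  | cons f l ih =>
    rw [pathWeight_cons, pathWeight_cons, ih fun g hg => hl g (List.mem_cons_of_mem _ hg)]
    congr 1
    have hf := hl f List.mem_cons_self
    unfold transition killed
    by_cases h : f.1 = head (l.headD e)
    · rw [if_pos h, if_pos ⟨h, hf⟩, h]
      rfl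
    · rw [if_neg h, if_neg fun h' => h h'.1]

/-- The Green function is exhausted by those of the walks killed outside finite sets, since each
path visits finitely many vertices. -/
lemma green_toEnvironment_le_iSup (hZ : ∀ i j, 0 < Z i j) (u : (Fin d → ℤ) → OpenSimplex (Dir d))
    (e f : Edge d) :
    green (toEnvironment Z hZ u) e f ≤ ⨆ B, greenSum (killed Z B u) e f := by
  rw [green_eq_greenSum, greenSum, ENNReal.tsum_eq_iSup_sum]
  refine iSup_le fun S => ?_
  let B : Finset (Fin d → ℤ) := S.biUnion fun l => (l.map Prod.fst).toFinset
  refine le_trans ?_ (le_iSup (fun B => greenSum (killed Z B u) e f) B)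
  refine le_trans (le_of_eq (Finset.sum_congr rfl fun l hl => ?_)) (ENNReal.sum_le_tsum S)
  rw [pathWeight_transition_eq (B := B) hZ u e fun g hg => ?_]
  exact Finset.mem_biUnion.2 ⟨l, hl, List.mem_toFinset.2 (List.mem_map_of_mem hg)⟩

end Killing

section GreenMoments

variable {d : ℕ} [NeZero d] {α : Dir d → ℝ} {Z : Matrix (Dir d) (Dir d) ℝ}

lemma lintegral_prod_tilt (hα : ∀ i, 0 < α i) (hZ : ∀ i j, 0 < Z i j) (a b : Edge d → ℝ)
    (B : Finset (Fin d → ℤ)) :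
    ∫⁻ u, ∏ x ∈ B, ENNReal.ofReal (tilt α a b Z x (u x)) ∂(vertexLaw α Z)
      = ∏ x ∈ B, tiltMass α a b Z x := by
  have := isProbabilityMeasure_hyperLaw ((0, true) : Dir d) hα hα hZ
  rw [vertexLaw_eq hα hZ, lintegral_prod_infinitePi _ B
    (fun x u => ENNReal.ofReal (tilt α a b Z x u))
    fun x => (measurable_monomial _ _ _).ennreal_ofReal]
  simp only [lintegral_tilt hZ]

omit [NeZero d] in
lemma tilt_rpow_mul_tilt_rpow (hZ : ∀ i j, 0 < Z i j) (e₀ : Edge d) {t P Q : ℝ} (hP : P ≠ 0)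
    (hQ : Q ≠ 0) (x : Fin d → ℤ) (v : OpenSimplex (Dir d)) :
    ENNReal.ofReal (tilt α (outParam α e₀ (t * P)) (inParam α e₀ (t * P)) Z x v) ^ (1 / P) *
      ENNReal.ofReal (tilt α (outParam α e₀ (-(t * Q))) (inParam α e₀ (-(t * Q))) Z x v) ^ (1 / Q)
      = 1 := by
  rw [tilt_outParam_inParam, tilt_outParam_inParam, monomial_mul_eq_exp hZ,
    monomial_mul_eq_exp hZ, ENNReal.ofReal_rpow_of_pos (Real.exp_pos _),
    ENNReal.ofReal_rpow_of_pos (Real.exp_pos _), ← ENNReal.ofReal_mul (by positivity),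
    ← Real.exp_mul, ← Real.exp_mul, ← Real.exp_add, ← ENNReal.ofReal_one, ← Real.exp_zero]
  congr 2
  field_simp
  ring

/-- Hölder's inequality separates the killed Green function, tilted along the flow, from the
density of the tilt; both factors are bounded uniformly in the finite set `B`. -/
lemma exists_lintegral_greenSum_killed_rpow_le (hd : 3 ≤ d) (hα : ∀ i, 0 < α i)
    (hZ : ∀ i j, 0 < Z i j) (e₀ : Edge d) {s : ℝ} (hs : 0 < s) (hsα : ∀ i, s < α i) :
    ∃ C : ℝ≥0∞, C ≠ ∞ ∧ ∀ B : Finset (Fin d → ℤ),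
      ∫⁻ u, greenSum (killed Z B u) e₀ e₀ ^ s ∂(vertexLaw α Z) ≤ C := by
  have hd1 : 1 ≤ d := by omega
  obtain ⟨k, hk⟩ := Finite.exists_min α
  set t := (s + α k) / 2 with ht
  have hst : s < t := by rw [ht]; linarith [hsα k]
  have htk : t < α k := by rw [ht]; linarith [hsα k]
  -- With `P = q / s` and its conjugate `Q = q / (q - s)`, the conditions are `q < t * P` and
  -- `t * Q < α k`; the second one holds for large `q`.
  obtain ⟨q, hq⟩ := exists_nat_gt (max s (α k * s / (α k - t)))
  have hqs : s < q := (le_max_left _ _).trans_lt hq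
  have hqk : α k * s < q * (α k - t) := by
    have := (le_max_right _ _).trans_lt hq
    rwa [div_lt_iff₀ (by linarith)] at this
  have hq0 : (0 : ℝ) < q := hs.trans hqs
  have hqs0 : 0 < q - s := by linarith
  set P : ℝ := q / s with hP
  set Q : ℝ := q / (q - s) with hQ
  have hP0 : 0 < P := by positivity
  have hQ0 : 0 < Q := by positivity
  have hPQ : P.HolderConjugate Q := by
    rw [Real.holderConjugate_iff]
    refine ⟨by rw [hP, one_lt_div hs]; exact hqs, ?_⟩
    rw [hP, hQ]
    field_simp
    ring
  have ht0 : 0 < t := hs.trans hst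
  have htQ : ∀ i, t * Q < α i := fun i => by
    refine lt_of_lt_of_le ?_ (hk i)
    rw [hQ, mul_div_assoc', div_lt_iff₀ hqs0]
    nlinarith
  have htP : (q : ℝ) < t * P := by
    rw [hP, mul_div_assoc', lt_div_iff₀ hs]
    nlinarith
  have hP' : ∀ i, -α i < t * P := fun i => by linarith [hα i]
  obtain ⟨C, hC, hCB⟩ := exists_prod_tiltMass_le hd hα hZ e₀ ht0 hPQ htQ
  set a := outParam α e₀ (t * P) with ha
  set b := inParam α e₀ (t * P) with hb
  set a' := outParam α e₀ (-(t * Q)) with ha'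
  set b' := inParam α e₀ (-(t * Q)) with hb'
  set K := ENNReal.ofReal (beta (a e₀) (t * P - q) / beta (a e₀) (t * P)) with hK
  refine ⟨C * K ^ (1 / P), ENNReal.mul_ne_top hC
    (ENNReal.rpow_ne_top_of_nonneg (by positivity) ENNReal.ofReal_ne_top), fun B => ?_⟩
  let T : ((Fin d → ℤ) → OpenSimplex (Dir d)) → ℝ≥0∞ :=
    fun u => ∏ x ∈ B, ENNReal.ofReal (tilt α a b Z x (u x))
  let R : ((Fin d → ℤ) → OpenSimplex (Dir d)) → ℝ≥0∞ :=
    fun u => ∏ x ∈ B, ENNReal.ofReal (tilt α a' b' Z x (u x))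
  let G : ((Fin d → ℤ) → OpenSimplex (Dir d)) → ℝ≥0∞ := fun u => greenSum (killed Z B u) e₀ e₀
  have hmT : ∀ a b : Edge d → ℝ, Measurable fun u : (Fin d → ℤ) → OpenSimplex (Dir d) =>
      ∏ x ∈ B, ENNReal.ofReal (tilt α a b Z x (u x)) := fun a b =>
    Finset.measurable_prod _ fun x _ =>
      (measurable_monomial _ _ _).ennreal_ofReal.comp (measurable_pi_apply x)
  have hmG : Measurable G := measurable_greenSum (measurable_killed B) e₀ e₀
  -- `T ^ (1 / P)` and `R ^ (1 / Q)` are the density of the same tilt with exponents `t` and `-t`.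
  have hTR : ∀ u, T u ^ (1 / P) * R u ^ (1 / Q) = 1 := fun u => by
    simp only [T, R]
    rw [← ENNReal.prod_rpow_of_nonneg (by positivity),
      ← ENNReal.prod_rpow_of_nonneg (by positivity), ← Finset.prod_mul_distrib]
    exact Finset.prod_eq_one fun x _ => tilt_rpow_mul_tilt_rpow hZ e₀ hP0.ne' hQ0.ne' x (u x)
  have hG : ∀ u, G u ^ s = (T u * G u ^ q) ^ (1 / P) * R u ^ (1 / Q) := fun u => by
    rw [ENNReal.mul_rpow_of_nonneg _ _ (by positivity), mul_right_comm, hTR, one_mul,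
      ← ENNReal.rpow_natCast, ← ENNReal.rpow_mul]
    congr 1
    rw [hP]
    field_simp
  have hpow : ∀ (y : ℝ≥0∞) {p : ℝ}, 0 < p → (y ^ (1 / p)) ^ p = y := fun y p hp => by
    rw [← ENNReal.rpow_mul, one_div_mul_cancel hp.ne', ENNReal.rpow_one]
  have hholder := ENNReal.lintegral_mul_le_Lp_mul_Lq (vertexLaw α Z) hPQ
    (f := fun u => (T u * G u ^ q) ^ (1 / P)) (g := fun u => R u ^ (1 / Q))
    (((hmT a b).mul (hmG.pow_const q)).pow_const _).aemeasurable
    ((hmT a' b').pow_const _).aemeasurable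
  simp only [Pi.mul_apply, hpow _ hP0, hpow _ hQ0, ← hG] at hholder
  refine hholder.trans ?_
  have hb₀ : b e₀ = a e₀ + t * P := by
    rw [hb, ha, inParam, outParam, if_pos rfl]
    ring
  have hbne : ∀ e, e ≠ e₀ → b e = a e := fun e he => by
    rw [hb, ha, inParam, outParam, if_neg he, add_zero]
  have h1 := lintegral_tilt_mul_greenSum_pow_le hα hZ (outParam_pos hd1 hα e₀ hP') htP hb₀ hbne
    (B := B) fun x _ => sum_outParam_eq_sum_inParam hd1 α e₀ (t * P) x
  have h2 := lintegral_prod_tilt hα hZ a' b' B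
  calc (∫⁻ u, T u * G u ^ q ∂(vertexLaw α Z)) ^ (1 / P) *
        (∫⁻ u, R u ∂(vertexLaw α Z)) ^ (1 / Q)
      ≤ ((∏ x ∈ B, tiltMass α a b Z x) * K) ^ (1 / P) *
          (∏ x ∈ B, tiltMass α a' b' Z x) ^ (1 / Q) := by
        rw [show ∫⁻ u, R u ∂(vertexLaw α Z) = _ from h2]
        gcongr
    _ = (∏ x ∈ B, (tiltMass α a b Z x ^ (1 / P) * tiltMass α a' b' Z x ^ (1 / Q))) *
          K ^ (1 / P) := by
        rw [ENNReal.mul_rpow_of_nonneg _ _ (by positivity), Finset.prod_mul_distrib,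
          ENNReal.prod_rpow_of_nonneg (by positivity),
          ENNReal.prod_rpow_of_nonneg (by positivity), mul_right_comm]
    _ ≤ C * K ^ (1 / P) := by
        gcongr
        exact hCB B

theorem lintegral_green_rpow_lt_top (hd : 3 ≤ d) (hα : ∀ i, 0 < α i) (hZ : ∀ i j, 0 < Z i j)
    (e₀ : Edge d) {s : ℝ} (hs : 0 < s) (hsα : ∀ i, s < α i) :
    ∫⁻ ω, green ω e₀ e₀ ^ s ∂(envLaw α Z hZ) < ∞ := by
  obtain ⟨C, hC, hCB⟩ := exists_lintegral_greenSum_killed_rpow_le hd hα hZ e₀ hs hsα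
  rw [envLaw, lintegral_map ((measurable_green e₀ e₀).pow_const s) (measurable_toEnvironment Z hZ)]
  refine lt_of_le_of_lt ?_ hC.lt_top
  calc ∫⁻ u, green (toEnvironment Z hZ u) e₀ e₀ ^ s ∂(vertexLaw α Z)
      ≤ ∫⁻ u, ⨆ B, greenSum (killed Z B u) e₀ e₀ ^ s ∂(vertexLaw α Z) := by
        refine lintegral_mono fun u => ?_
        refine (ENNReal.rpow_le_rpow (green_toEnvironment_le_iSup hZ u e₀ e₀) hs.le).trans ?_
        exact ((ENNReal.orderIsoRpow s hs).map_iSup fun B => greenSum (killed Z B u) e₀ e₀).le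
    _ = ⨆ B, ∫⁻ u, greenSum (killed Z B u) e₀ e₀ ^ s ∂(vertexLaw α Z) := by
        refine lintegral_iSup_directed_of_measurable (fun B =>
          (measurable_greenSum (measurable_killed B) e₀ e₀).pow_const s) ?_
        refine Monotone.directed_le fun B B' h u => ?_
        exact ENNReal.rpow_le_rpow (greenSum_killed_mono u e₀ e₀ h) hs.le
    _ ≤ C := iSup_le hCB

end GreenMoments

end HypergeometricRWRE

open HypergeometricRWRE in
theorem mainTheorem1 (d : ℕ) [NeZero d] (hd : 3 ≤ d) (α : Dir d → ℝ) (hα : ∀ i, 0 < α i)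
    (Z : Matrix (Dir d) (Dir d) ℝ) (hZ : ∀ i j, 0 < Z i j) (e₀ : Edge d) :
    (∀ s : ℝ, s < (⨅ i, α i) → (∫⁻ ω, (green ω e₀ e₀) ^ s ∂(envLaw α Z hZ)) < ∞) ∧
      (∀ᵐ ω ∂(envLaw α Z hZ), IsTransient ω e₀) := by
  have hprob := isProbabilityMeasure_envLaw hα hZ
  refine ⟨fun s hs => ?_, ?_⟩
  · rcases le_or_gt s 0 with h0 | h0
    -- The Green function is at least `1`, so powers with nonpositive exponents are at most `1`.
    · refine lt_of_le_of_lt (lintegral_mono (g := fun _ => 1) fun ω => ?_) (by simp)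
      rcases h0.eq_or_lt with rfl | h0
      · rw [ENNReal.rpow_zero]
      · exact ENNReal.rpow_le_one_of_one_le_of_neg (one_le_green ω e₀) h0
    · exact lintegral_green_rpow_lt_top hd hα hZ e₀ h0 fun i =>
        hs.trans_le (ciInf_le (Set.finite_range α).bddBelow i)
  · obtain ⟨k, hk⟩ := Finite.exists_min α
    have hpos := hα k
    have h : ∀ᵐ ω ∂(envLaw α Z hZ), ∀ f, green ω f f < ∞ := by
      rw [ae_all_iff]
      intro f
      have hfin := lintegral_green_rpow_lt_top hd hα hZ f (half_pos hpos) fun i =>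
        (half_lt_self hpos).trans_le (hk i)
      filter_upwards [ae_lt_top ((measurable_green f f).pow_const _) hfin.ne] with ω hω
      rwa [ENNReal.rpow_lt_top_iff_of_pos (half_pos hpos)] at hω
    filter_upwards [h] with ω hω
    exact isTransient_of_green_lt_top e₀ hω
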